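/- Let $\Omega\subset\mathbb R^m$ be a bounded domain (open, connected) with smooth boundary, write $\mathcal B=\overline\Omega$ and $\partial\mathcal B=\partial\Omega$, let $dx$ be the volume on $\mathcal B$ and $ds$ the area element on $\partial\mathcal B$ (counting measure if $m=1$). Let $V=C^\infty(\mathcal B)$ be the space of restrictions to $\mathcal B$ of functions in $C^\infty(\mathbb R^m)$, with the finest topology making the restriction map from the Fréchet space $C^\infty(\mathbb R^m)$ continuous, and let $V'$ be its topological dual. Let the restricted dual $V^\star=C^\infty(\mathcal B)\times C^\infty(\partial\mathcal B)$ be regarded as a subspace of $V'$ through $$\langle(\alpha,\alpha_\partial),\psi\rangle=\int_{\mathcal B}\alpha\,\psi\,dx+\int_{\partial\mathcal B}\alpha_\partial\,\psi\,ds,\qquad \psi\in V .$$ Let $\mathfrak L=\mathfrak L(\varphi,\nu,\nabla\varphi):\mathbb R\times\mathbb R\times\mathbb R^m\to\mathbb R$ be smooth and let $$L:V\times V\to\mathbb R,\qquad L(\varphi,\nu)=\int_{\mathcal B}\mathfrak L(\varphi(x),\nu(x),\nabla\varphi(x))\,dx .$$ Then for all $(\varphi,\nu)\in V\times V$ the partial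 functional derivatives $$\frac{\delta L}{\delta\varphi}(\varphi,\nu)(\delta\varphi)=\left.\frac{d}{d\epsilon}\right|_{\epsilon=0}L(\varphi+\epsilon\,\delta\varphi,\nu),\qquad \frac{\delta L}{\delta\nu}(\varphi,\nu)(\delta\nu)=\left.\frac{d}{d\epsilon}\right|_{\epsilon=0}L(\varphi,\nu+\epsilon\,\delta\nu),\qquad \delta\varphi,\delta\nu\in V,$$ exist, are elements of $V'$ and lie in $V^\star$. Explicitly, $$\frac{\delta L}{\delta\varphi}(\varphi,\nu)=\left(\frac{\partial\mathfrak L}{\partial\varphi}(\varphi,\nu,\nabla\varphi)-\operatorname{div}\frac{\partial\mathfrak L}{\partial\nabla\varphi}(\varphi,\nu,\nabla\varphi),\ \left.\frac{\partial\mathfrak L}{\partial\nabla\varphi}(\varphi,\nu,\nabla\varphi)\right|_{\partial\mathcal B}\cdot n\right),\qquad \frac{\delta L}{\delta\nu}(\varphi,\nu)=\left(\frac{\partial\mathfrak L}{\partial\nu}(\varphi,\nu,\nabla\varphi),\ 0\right),$$ where $\operatorname{div}\omega=\sum_{i=1}^m\partial\omega^i/\partial x^i$, the dot is the standard inner product of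 $\mathbb R^m$, and $n\in C^\infty(\partial\mathcal B,\mathbb R^m)$ is the outward-pointing unit normal vector field on $\partial\mathcal B$. -/

import Mathlib

open MeasureTheory
open scoped ContDiff Topology MeasureTheory

noncomputable section

/-- Euclidean space `ℝ^m`. -/
abbrev Euc (m : ℕ) : Type := EuclideanSpace ℝ (Fin m)

/-! ### Bounded domains with smooth boundary -/

/-- `ρ` is a smooth defining function of the open set `Ω` near the boundary point `p`: near `p`,
`Ω` is the sublevel set `{ρ < 0}`, and `∇ρ(p) ≠ 0`. -/
structure IsLocalDefiningFunction {m : ℕ} (Ω : Set (Euc m)) (p : Euc m) (ρ : Euc m → ℝ) :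
    Prop where
  smooth : ContDiff ℝ ∞ ρ
  eventually_mem_iff : ∀ᶠ x in 𝓝 p, (x ∈ Ω ↔ ρ x < 0)
  gradient_ne_zero : gradient ρ p ≠ 0

/-- A bounded domain (open connected set) `Ω ⊂ ℝ^m` with smooth boundary. The compact domain with
boundary on which functions are considered is `closure Ω`; its boundary is `frontier Ω`. -/
structure IsSmoothBoundedDomain {m : ℕ} (Ω : Set (Euc m)) : Prop where
  isOpen : IsOpen Ω
  isConnected : IsConnected Ω
  isBounded : Bornology.IsBounded Ω
  smooth_boundary : ∀ p ∈ frontier Ω, ∃ ρ, IsLocalDefiningFunction Ω p ρ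

open Classical in
/-- The outward-pointing unit normal of `Ω` at the boundary point `p`: the normalized gradient
`∇ρ(p) / |∇ρ(p)|` of a defining function near `p` (which one is immaterial, see
`outwardUnitNormal_eq`). -/
def outwardUnitNormal {m : ℕ} (Ω : Set (Euc m)) (p : Euc m) : Euc m :=
  if h : ∃ ρ, IsLocalDefiningFunction Ω p ρ then
    ‖gradient h.choose p‖⁻¹ • gradient h.choose p
  else 0

/-- A defining function vanishes on the boundary. -/
theorem IsLocalDefiningFunction.eq_zero {m : ℕ} {Ω : Set (Euc m)} (hΩ : IsOpen Ω) {p : Euc m}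
    (hp : p ∈ frontier Ω) {ρ : Euc m → ℝ} (h : IsLocalDefiningFunction Ω p ρ) : ρ p = 0 := by
  have h1 : p ∉ Ω := by
    have := hp.2
    rwa [hΩ.interior_eq] at this
  have h2 : 0 ≤ ρ p := by
    by_contra hneg
    exact h1 (h.eventually_mem_iff.self_of_nhds.2 (not_le.1 hneg))
  refine le_antisymm ?_ h2
  by_contra hpos
  have h3 : ∀ᶠ x in 𝓝 p, 0 < ρ x :=
    h.smooth.continuous.continuousAt.eventually (lt_mem_nhds (not_le.1 hpos))
  have h4 : ∃ᶠ x in 𝓝 p, x ∈ Ω := mem_closure_iff_frequently.1 hp.1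
  obtain ⟨x, hx, hx1, hx2⟩ := (h4.and_eventually (h3.and h.eventually_mem_iff)).exists
  exact absurd (hx2.1 hx) (not_lt.2 hx1.le)

/-- The sign of `ρ` just after leaving a zero in a direction along which it has a slope. -/
theorem eventually_pos_of_inner_gradient_pos {m : ℕ} {p w : Euc m} {ρ : Euc m → ℝ}
    (hρ : DifferentiableAt ℝ ρ p) (h0 : ρ p = 0) (hw : 0 < inner ℝ (gradient ρ p) w) :
    ∀ᶠ t : ℝ in 𝓝[>] 0, 0 < ρ (p + t • w) := by
  have hl : HasDerivAt (fun t : ℝ => p + t • w) w 0 := by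
    simpa using ((hasDerivAt_id (0 : ℝ)).smul_const w).const_add p
  have hg : HasFDerivAt ρ (InnerProductSpace.toDual ℝ (Euc m) (gradient ρ p))
      (p + (0 : ℝ) • w) := by
    simpa using hρ.hasGradientAt.hasFDerivAt
  have hd := hg.comp_hasDerivAt (0 : ℝ) hl
  have hs := hd.tendsto_slope_zero_right
  have hpos : ∀ᶠ t : ℝ in 𝓝[>] 0,
      0 < t⁻¹ • ((ρ ∘ fun t : ℝ => p + t • w) (0 + t) - (ρ ∘ fun t : ℝ => p + t • w) 0) :=
    hs.eventually (lt_mem_nhds (by simpa using hw))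
  filter_upwards [hpos, self_mem_nhdsWithin] with t ht ht0
  have ht0' : (0 : ℝ) < t := ht0
  have h3 : 0 < t⁻¹ * ρ (p + t • w) := by simpa [h0] using ht
  exact (pos_iff_pos_of_mul_pos h3).1 (inv_pos.2 ht0')

/-- The outward unit normal can be computed from any defining function. -/
theorem outwardUnitNormal_eq {m : ℕ} {Ω : Set (Euc m)} (hΩ : IsOpen Ω) {p : Euc m}
    (hp : p ∈ frontier Ω) {ρ : Euc m → ℝ} (h : IsLocalDefiningFunction Ω p ρ) :
    outwardUnitNormal Ω p = ‖gradient ρ p‖⁻¹ • gradient ρ p := by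
  have hex : ∃ ρ, IsLocalDefiningFunction Ω p ρ := ⟨ρ, h⟩
  rw [outwardUnitNormal, dif_pos hex]
  have h' := hex.choose_spec
  generalize hex.choose = σ at h'
  have key : ∀ ρ σ : Euc m → ℝ, IsLocalDefiningFunction Ω p ρ → IsLocalDefiningFunction Ω p σ →
      ∀ w : Euc m, 0 < inner ℝ (gradient ρ p) w → ¬ inner ℝ (gradient σ p) w < 0 := by
    intro ρ σ h h' w hw hw'
    have e1 := eventually_pos_of_inner_gradient_pos
      (h.smooth.differentiable (by simp) p) (h.eq_zero hΩ hp) hw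
    have e2 := eventually_pos_of_inner_gradient_pos (ρ := fun x => - σ x) (w := w)
      (h'.smooth.neg.differentiable (by simp) p) (by simp [h'.eq_zero hΩ hp]) (by
        have : gradient (fun x => - σ x) p = - gradient σ p := by
          simp [gradient]
        rw [this, inner_neg_left]; linarith)
    have hl : Filter.Tendsto (fun t : ℝ => p + t • w) (𝓝[>] 0) (𝓝 p) := by
      have : Continuous (fun t : ℝ => p + t • w) := by fun_prop
      have h0 := this.tendsto 0
      simp only [zero_smul, add_zero] at h0
      exact h0.mono_left nhdsWithin_le_nhds
    obtain ⟨t, t1, t2, t3, t4⟩ := (e1.and (e2.and ((hl.eventually h.eventually_mem_iff).and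
      (hl.eventually h'.eventually_mem_iff)))).exists
    have hlt : σ (p + t • w) < 0 := by linarith
    exact absurd (t3.1 (t4.2 hlt)) (not_lt.2 t1.le)
  by_contra hne
  have n1 : ‖gradient σ p‖ ≠ 0 := norm_ne_zero_iff.2 h'.gradient_ne_zero
  have n2 : ‖gradient ρ p‖ ≠ 0 := norm_ne_zero_iff.2 h.gradient_ne_zero
  set u := ‖gradient σ p‖⁻¹ • gradient σ p with hu
  set v := ‖gradient ρ p‖⁻¹ • gradient ρ p with hv
  have u1 : ‖u‖ = 1 := by rw [hu, norm_smul, norm_inv, norm_norm, inv_mul_cancel₀ n1]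
  have v1 : ‖v‖ = 1 := by rw [hv, norm_smul, norm_inv, norm_norm, inv_mul_cancel₀ n2]
  have huv : inner ℝ u v < 1 := (inner_lt_one_iff_real_of_norm_eq_one u1 v1).2 hne
  have gu : gradient σ p = ‖gradient σ p‖ • u := by rw [hu, smul_smul, mul_inv_cancel₀ n1, one_smul]
  have gv : gradient ρ p = ‖gradient ρ p‖ • v := by rw [hv, smul_smul, mul_inv_cancel₀ n2, one_smul]
  have p1 : 0 < ‖gradient σ p‖ := lt_of_le_of_ne (norm_nonneg _) n1.symm
  have p2 : 0 < ‖gradient ρ p‖ := lt_of_le_of_ne (norm_nonneg _) n2.symm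
  refine key ρ σ h h' (v - u) ?_ ?_
  · rw [gv, inner_smul_left, inner_sub_right, real_inner_self_eq_norm_sq, v1, real_inner_comm]
    exact mul_pos p2 (by linarith)
  · rw [gu, inner_smul_left, inner_sub_right, real_inner_self_eq_norm_sq, u1]
    exact mul_neg_of_pos_of_neg p1 (by linarith)

/-! ### Spaces of smooth functions -/

/-- The restrictions to `S` of smooth maps `ℝ^m → F`, as a space of maps on `S`. -/
def smoothSubmodule {m : ℕ} (S : Set (Euc m)) (F : Type) [NormedAddCommGroup F]
    [NormedSpace ℝ F] : Submodule ℝ (S → F) where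
  carrier := {f | ∃ g : Euc m → F, ContDiff ℝ ∞ g ∧ ∀ x : S, f x = g x}
  zero_mem' := ⟨fun _ => 0, contDiff_const, fun _ => rfl⟩
  add_mem' := by
    rintro f₁ f₂ ⟨g₁, h₁, e₁⟩ ⟨g₂, h₂, e₂⟩
    exact ⟨fun x => g₁ x + g₂ x, h₁.add h₂, fun x => by simp [e₁ x, e₂ x]⟩
  smul_mem' := by
    rintro c f ⟨g, h, e⟩
    exact ⟨fun x => c • g x, contDiff_const.smul h, fun x => by simp [e x]⟩

/-- `C^∞(S, F)`: maps on `S` that are restrictions of smooth maps on `ℝ^m`. It is used with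
`S = closure Ω` and with `S = frontier Ω`. (A separate type, so that it does not carry the topology
of pointwise convergence.) -/
def SmoothFun {m : ℕ} (S : Set (Euc m)) (F : Type) [NormedAddCommGroup F] [NormedSpace ℝ F] :
    Type :=
  smoothSubmodule S F

namespace SmoothFun

variable {m : ℕ} {S : Set (Euc m)} {F : Type} [NormedAddCommGroup F] [NormedSpace ℝ F]

instance : AddCommGroup (SmoothFun S F) := inferInstanceAs (AddCommGroup (smoothSubmodule S F))

instance : Module ℝ (SmoothFun S F) := inferInstanceAs (Module ℝ (smoothSubmodule S F))

/-- The underlying map on `S`. -/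
def toFun (f : SmoothFun S F) : S → F := Subtype.val (p := (· ∈ smoothSubmodule S F)) f

instance : CoeFun (SmoothFun S F) (fun _ => S → F) := ⟨toFun⟩

@[ext] theorem ext {f g : SmoothFun S F} (h : ∀ x, f x = g x) : f = g :=
  Subtype.ext (funext h)

theorem exists_extension (f : SmoothFun S F) :
    ∃ g : Euc m → F, ContDiff ℝ ∞ g ∧ ∀ x : S, f x = g x := f.2


@[simp] theorem add_apply (f g : SmoothFun S F) (x : S) : (f + g) x = f x + g x := rfl

@[simp] theorem sub_apply (f g : SmoothFun S F) (x : S) : (f - g) x = f x - g x := rfl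

@[simp] theorem smul_apply (c : ℝ) (f : SmoothFun S F) (x : S) : (c • f) x = c • f x := rfl

@[simp] theorem zero_apply (x : S) : (0 : SmoothFun S F) x = 0 := rfl

/-- The restriction to `S` of a smooth map on `ℝ^m`. -/
def mk (g : Euc m → F) (hg : ContDiff ℝ ∞ g) : SmoothFun S F := ⟨fun x => g x, g, hg, fun _ => rfl⟩

@[simp] theorem mk_apply (g : Euc m → F) (hg : ContDiff ℝ ∞ g) (x : S) :
    (mk g hg : SmoothFun S F) x = g x := rfl

/-- Some smooth extension of `f` to `ℝ^m`. -/
def extension (f : SmoothFun S F) : Euc m → F := f.exists_extension.choose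

theorem contDiff_extension (f : SmoothFun S F) : ContDiff ℝ ∞ f.extension :=
  f.exists_extension.choose_spec.1

theorem extension_apply (f : SmoothFun S F) (x : S) : f.extension x = f x :=
  (f.exists_extension.choose_spec.2 x).symm

/-- On the closure of an open set, the derivative of an extension does not depend on the
extension. -/
theorem fderiv_extension_eq {Ω : Set (Euc m)} (hΩ : IsOpen Ω) (f : SmoothFun (closure Ω) F)
    {g : Euc m → F} (hg : ContDiff ℝ ∞ g) (hfg : ∀ x : closure Ω, f x = g x)
    (x : closure Ω) : fderiv ℝ f.extension x = fderiv ℝ g x := by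
  have h1 : Set.EqOn (fderiv ℝ f.extension) (fderiv ℝ g) Ω := by
    intro y hy
    refine Filter.EventuallyEq.fderiv_eq ?_
    filter_upwards [hΩ.mem_nhds hy] with z hz
    rw [← hfg ⟨z, subset_closure hz⟩, ← f.extension_apply]
  exact h1.closure (f.contDiff_extension.continuous_fderiv (by simp))
    (hg.continuous_fderiv (by simp)) x.2

/-- The gradient `∇φ = (∂φ/∂x¹, …, ∂φ/∂xᵐ)`, a smooth vector field. -/
def grad (φ : SmoothFun S ℝ) : SmoothFun S (Euc m) :=
  mk (fun x => gradient φ.extension x) <|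
    (InnerProductSpace.toDual ℝ (Euc m)).symm.contDiff.comp
      (φ.contDiff_extension.fderiv_right (m := ∞) (by simp))

/-- The divergence `div X = ∑ᵢ ∂Xⁱ/∂xⁱ`. -/
def div (X : SmoothFun S (Euc m)) : SmoothFun S ℝ :=
  mk (fun x => ∑ i, (fderiv ℝ X.extension x (EuclideanSpace.single i 1)) i) <| by
    refine ContDiff.sum fun i _ => ?_
    exact (EuclideanSpace.proj (𝕜 := ℝ) i).contDiff.comp
      ((X.contDiff_extension.fderiv_right (m := ∞) (by simp)).clm_apply contDiff_const)

/-- The restriction of a smooth map on `S` to a smaller set. -/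
def restrict {T : Set (Euc m)} (h : T ⊆ S) (f : SmoothFun S F) : SmoothFun T F :=
  ⟨fun x => f ⟨x, h x.2⟩, f.extension, f.contDiff_extension,
    fun x => (f.extension_apply ⟨x, h x.2⟩).symm⟩

/-- The pointwise standard inner product of two smooth vector fields. -/
def dot (X Y : SmoothFun S (Euc m)) : SmoothFun S ℝ :=
  ⟨fun x => inner ℝ (X x) (Y x), fun x => inner ℝ (X.extension x) (Y.extension x),
    X.contDiff_extension.inner ℝ Y.contDiff_extension,
    fun x => by simp only [extension_apply]⟩

end SmoothFun

/-! ### The Fréchet topology and the topological dual -/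

/-- `C^∞(ℝ^m)`, as a space of functions. -/
def globalSmoothSubmodule (m : ℕ) : Submodule ℝ (Euc m → ℝ) where
  carrier := {f | ContDiff ℝ ∞ f}
  zero_mem' := (contDiff_const : ContDiff ℝ ∞ fun _ : Euc m => (0 : ℝ))
  add_mem' := by
    intro f g hf hg
    exact ContDiff.add (show ContDiff ℝ ∞ f from hf) (show ContDiff ℝ ∞ g from hg)
  smul_mem' := by
    intro c f hf
    exact ContDiff.const_smul c (show ContDiff ℝ ∞ f from hf)

/-- `C^∞(ℝ^m)`. (A separate type, so that it does not carry the topology of pointwise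
convergence.) -/
def GlobalSmooth (m : ℕ) : Type := globalSmoothSubmodule m

namespace GlobalSmooth

variable {m : ℕ}

instance : AddCommGroup (GlobalSmooth m) := inferInstanceAs (AddCommGroup (globalSmoothSubmodule m))

instance : Module ℝ (GlobalSmooth m) := inferInstanceAs (Module ℝ (globalSmoothSubmodule m))

/-- The underlying function. -/
def toFun (f : GlobalSmooth m) : Euc m → ℝ := Subtype.val (p := (· ∈ globalSmoothSubmodule m)) f

theorem contDiff (f : GlobalSmooth m) : ContDiff ℝ ∞ f.toFun := f.2

/-- The `k`-th derivative of `f`, as a continuous map on the closed ball of radius `n`. -/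
def derivOnBall (n k : ℕ) :
    GlobalSmooth m →ₗ[ℝ] C(Metric.closedBall (0 : Euc m) n, Euc m [×k]→L[ℝ] ℝ) where
  toFun f := ⟨fun x => iteratedFDeriv ℝ k f.toFun x,
    (f.contDiff.continuous_iteratedFDeriv (by exact_mod_cast le_top)).comp continuous_subtype_val⟩
  map_add' f g := by
    ext1 x
    exact iteratedFDeriv_add_apply
      (f.contDiff.of_le (by exact_mod_cast le_top)).contDiffAt
      (g.contDiff.of_le (by exact_mod_cast le_top)).contDiffAt
  map_smul' c f := by
    ext1 x
    exact iteratedFDeriv_const_smul_apply (f.contDiff.of_le (by exact_mod_cast le_top)).contDiffAt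

/-- The seminorm `p_n(f) = max {|∂^k f(x)| : |x| ≤ n, k ≤ n}`. -/
def seminormFamily (m : ℕ) : SeminormFamily ℝ (GlobalSmooth m) ℕ := fun n =>
  (Finset.range (n + 1)).sup fun k =>
    (normSeminorm ℝ C(Metric.closedBall (0 : Euc m) n, Euc m [×k]→L[ℝ] ℝ)).comp
      (derivOnBall n k)

/-- The Fréchet topology of `C^∞(ℝ^m)`. -/
instance : TopologicalSpace (GlobalSmooth m) := (seminormFamily m).moduleFilterBasis.topology

/-- Restriction `C^∞(ℝ^m) → C^∞(S)`. -/
def restrict (S : Set (Euc m)) (f : GlobalSmooth m) : SmoothFun S ℝ := SmoothFun.mk f.toFun f.contDiff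

end GlobalSmooth

/-- The topology of `C^∞(S)`: the finest one for which the restriction map from `C^∞(ℝ^m)` is
continuous. -/
instance {m : ℕ} (S : Set (Euc m)) : TopologicalSpace (SmoothFun S ℝ) :=
  TopologicalSpace.coinduced (GlobalSmooth.restrict S) inferInstance

/-- The topological dual `V'` of `V = C^∞(closure Ω)`. -/
abbrev TopDual {m : ℕ} (Ω : Set (Euc m)) : Type := SmoothFun (closure Ω) ℝ →L[ℝ] ℝ

/-! ### The restricted dual -/

/-- The volume `dx` on `closure Ω`. -/
def bodyMeasure {m : ℕ} (Ω : Set (Euc m)) : Measure (closure Ω) :=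
  (volume : Measure (Euc m)).comap Subtype.val

/-- The area element `ds` on the boundary: the `(m-1)`-dimensional Hausdorff measure, normalized as
Lebesgue measure (counting measure if `m = 1`). -/
def boundaryMeasure {m : ℕ} (Ω : Set (Euc m)) : Measure (frontier Ω) :=
  (μHE[m - 1] : Measure (Euc m)).comap Subtype.val

/-- The restricted dual `V⋆ = C^∞(closure Ω) × C^∞(frontier Ω)`. -/
abbrev RestrictedDual {m : ℕ} (Ω : Set (Euc m)) : Type :=
  SmoothFun (closure Ω) ℝ × SmoothFun (frontier Ω) ℝ

/-- The pairing `∫_B α ψ dx + ∫_∂B α_∂ ψ ds` of `(α, α_∂) ∈ V⋆` with `ψ ∈ V`. -/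
def restrictedPairing {m : ℕ} {Ω : Set (Euc m)} (a : RestrictedDual Ω)
    (ψ : SmoothFun (closure Ω) ℝ) : ℝ :=
  ∫ x, a.1 x * ψ x ∂bodyMeasure Ω +
    ∫ x, a.2 x * ψ.restrict frontier_subset_closure x ∂boundaryMeasure Ω

/-- `T ∈ V'` is the element `(α, α_∂)` of `V⋆` under the identification of `V⋆` with a subspace of
`V'` by the pairing, both integrals of which converge. -/
def IsIdentifiedWith {m : ℕ} {Ω : Set (Euc m)} (T : TopDual Ω) (a : RestrictedDual Ω) : Prop :=
  ∀ ψ : SmoothFun (closure Ω) ℝ,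
    Integrable (fun x => a.1 x * ψ x) (bodyMeasure Ω) ∧
    Integrable (fun x => a.2 x * ψ.restrict frontier_subset_closure x) (boundaryMeasure Ω) ∧
    T ψ = restrictedPairing a ψ

/-! ### Lagrangians defined through a density -/

/-- `L(φ, ν) = ∫_B 𝔏(φ(x), ν(x), ∇φ(x)) dx`. -/
def lagrangian {m : ℕ} {Ω : Set (Euc m)} (ℓ : ℝ × ℝ × Euc m → ℝ)
    (φ ν : SmoothFun (closure Ω) ℝ) : ℝ :=
  ∫ x, ℓ (φ x, ν x, φ.grad x) ∂bodyMeasure Ω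

/-- `T ∈ V'` is the functional derivative of `J : V → ℝ` at `φ`, that is
`T(δφ) = d/dε|_{ε=0} J(φ + ε δφ)` for all `δφ ∈ V`, where the derivative exists. -/
def HasFunctionalDerivAt {m : ℕ} {Ω : Set (Euc m)} (J : SmoothFun (closure Ω) ℝ → ℝ)
    (T : TopDual Ω) (φ : SmoothFun (closure Ω) ℝ) : Prop :=
  ∀ δφ : SmoothFun (closure Ω) ℝ, HasDerivAt (fun ε : ℝ => J (φ + ε • δφ)) (T δφ) 0

section Density

variable {m : ℕ} {S : Set (Euc m)} {ℓ : ℝ × ℝ × Euc m → ℝ}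

/-- Substituting `(φ, ν, ∇φ)` into a smooth map gives a smooth map. -/
def alongJet {F : Type} [NormedAddCommGroup F] [NormedSpace ℝ F] (G : ℝ × ℝ × Euc m → F)
    (hG : ContDiff ℝ ∞ G) (φ ν : SmoothFun S ℝ) : SmoothFun S F :=
  ⟨fun x => G (φ x, ν x, φ.grad x),
    fun x => G (φ.extension x, ν.extension x, φ.grad.extension x),
    hG.comp (φ.contDiff_extension.prodMk (ν.contDiff_extension.prodMk
      φ.grad.contDiff_extension)),
    fun x => by simp only [SmoothFun.extension_apply]⟩

/-- `∂𝔏/∂φ`, the partial derivative in the first argument. -/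
def densityPartialPhi (ℓ : ℝ × ℝ × Euc m → ℝ) (z : ℝ × ℝ × Euc m) : ℝ :=
  deriv (fun s => ℓ (s, z.2.1, z.2.2)) z.1

/-- `∂𝔏/∂ν`, the partial derivative in the second argument. -/
def densityPartialNu (ℓ : ℝ × ℝ × Euc m → ℝ) (z : ℝ × ℝ × Euc m) : ℝ :=
  deriv (fun s => ℓ (z.1, s, z.2.2)) z.2.1

/-- `∂𝔏/∂∇φ`, the gradient in the third argument. -/
def densityPartialGrad (ℓ : ℝ × ℝ × Euc m → ℝ) (z : ℝ × ℝ × Euc m) : Euc m :=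
  gradient (fun ξ => ℓ (z.1, z.2.1, ξ)) z.2.2

theorem contDiff_densityPartialPhi (hℓ : ContDiff ℝ ∞ ℓ) :
    ContDiff ℝ ∞ (densityPartialPhi ℓ) := by
  have h : densityPartialPhi ℓ = fun z => fderiv ℝ ℓ z (1, 0, 0) := by
    funext z
    have h1 : HasDerivAt (fun s : ℝ => (s, z.2.1, z.2.2)) (1, 0, 0) z.1 :=
      (hasDerivAt_id z.1).prodMk (hasDerivAt_const _ _)
    exact ((hℓ.differentiable (by simp) z).hasFDerivAt.comp_hasDerivAt z.1 h1).deriv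
  rw [h]
  exact (hℓ.fderiv_right (m := ∞) (by simp)).clm_apply contDiff_const

theorem contDiff_densityPartialNu (hℓ : ContDiff ℝ ∞ ℓ) :
    ContDiff ℝ ∞ (densityPartialNu ℓ) := by
  have h : densityPartialNu ℓ = fun z => fderiv ℝ ℓ z (0, 1, 0) := by
    funext z
    have h1 : HasDerivAt (fun s : ℝ => (z.1, s, z.2.2)) (0, 1, 0) z.2.1 :=
      (hasDerivAt_const _ _).prodMk ((hasDerivAt_id z.2.1).prodMk (hasDerivAt_const _ _))
    exact ((hℓ.differentiable (by simp) z).hasFDerivAt.comp_hasDerivAt z.2.1 h1).deriv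
  rw [h]
  exact (hℓ.fderiv_right (m := ∞) (by simp)).clm_apply contDiff_const

theorem contDiff_densityPartialGrad (hℓ : ContDiff ℝ ∞ ℓ) :
    ContDiff ℝ ∞ (densityPartialGrad ℓ) := by
  have h : densityPartialGrad ℓ = fun z => (InnerProductSpace.toDual ℝ (Euc m)).symm
      ((fderiv ℝ ℓ z).comp ((ContinuousLinearMap.inr ℝ ℝ (ℝ × Euc m)).comp
        (ContinuousLinearMap.inr ℝ ℝ (Euc m)))) := by
    funext z
    have h1 : HasFDerivAt (fun ξ : Euc m => (z.1, z.2.1, ξ))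
        ((ContinuousLinearMap.inr ℝ ℝ (ℝ × Euc m)).comp (ContinuousLinearMap.inr ℝ ℝ (Euc m)))
        z.2.2 := by
      have h0 : HasFDerivAt (fun ξ : Euc m => (z.1, z.2.1, ξ))
          ((0 : Euc m →L[ℝ] ℝ).prod ((0 : Euc m →L[ℝ] ℝ).prod (ContinuousLinearMap.id ℝ (Euc m))))
          z.2.2 :=
        (hasFDerivAt_const z.1 z.2.2).prodMk
          ((hasFDerivAt_const z.2.1 z.2.2).prodMk (hasFDerivAt_id z.2.2))
      exact h0
    have h2 := (hℓ.differentiable (by simp) z).hasFDerivAt.comp z.2.2 h1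
    simp only [densityPartialGrad, gradient]
    exact congrArg _ h2.fderiv
  rw [h]
  exact (InnerProductSpace.toDual ℝ (Euc m)).symm.contDiff.comp
    ((hℓ.fderiv_right (m := ∞) (by simp)).clm_comp contDiff_const)

/-- `∂𝔏/∂φ (φ, ν, ∇φ)`. -/
def partialPhi (hℓ : ContDiff ℝ ∞ ℓ) (φ ν : SmoothFun S ℝ) : SmoothFun S ℝ :=
  alongJet (densityPartialPhi ℓ) (contDiff_densityPartialPhi hℓ) φ ν

/-- `∂𝔏/∂ν (φ, ν, ∇φ)`. -/
def partialNu (hℓ : ContDiff ℝ ∞ ℓ) (φ ν : SmoothFun S ℝ) : SmoothFun S ℝ :=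
  alongJet (densityPartialNu ℓ) (contDiff_densityPartialNu hℓ) φ ν

/-- `∂𝔏/∂∇φ (φ, ν, ∇φ)`, a smooth vector field. -/
def partialGrad (hℓ : ContDiff ℝ ∞ ℓ) (φ ν : SmoothFun S ℝ) : SmoothFun S (Euc m) :=
  alongJet (densityPartialGrad ℓ) (contDiff_densityPartialGrad hℓ) φ ν

end Density

/-- The integral that defines the Lagrangian converges. -/
theorem integrable_lagrangian {m : ℕ} {Ω : Set (Euc m)} (hΩ : Bornology.IsBounded Ω)
    {ℓ : ℝ × ℝ × Euc m → ℝ} (hℓ : ContDiff ℝ ∞ ℓ) (φ ν : SmoothFun (closure Ω) ℝ) :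
    Integrable (fun x => ℓ (φ x, ν x, φ.grad x)) (bodyMeasure Ω) := by
  let f := alongJet ℓ hℓ φ ν
  have hK : IsCompact (closure Ω) := hΩ.isCompact_closure
  have h1 : IntegrableOn f.extension (closure Ω) :=
    f.contDiff_extension.continuous.continuousOn.integrableOn_compact hK
  have h2 := (MeasurableEmbedding.subtype_coe
    (isClosed_closure (s := Ω)).measurableSet).integrableOn_range_iff_comap.1
      (by rwa [Subtype.range_coe] : IntegrableOn f.extension (Set.range Subtype.val) volume)
  refine h2.congr (Filter.Eventually.of_forall fun x => ?_)
  exact f.extension_apply x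

end

/-!
The functional derivatives are first variations: differentiating under the integral sign
(`hasDerivAt_integral_comp_add_smul`) gives `∫ (∂𝔏/∂φ δφ + ⟨∂𝔏/∂∇φ, ∇δφ⟩) dx` and `∫ ∂𝔏/∂ν δν dx`.
The second is already of the desired form; the first becomes so after an integration by parts
(`integral_inner_grad`), whose boundary term produces the component in `C^∞(∂B)`. That every
element of the restricted dual is continuous on `V` is `exists_isIdentifiedWith`: a pairing is
bounded by the supremum over the compact domain, since volume and area are finite.

The substance is the divergence theorem for a smooth domain with the Hausdorff measure as the area
element, in the form `∫_Ω ∂ᵥ f dx = ∫_∂Ω f ⟨v, n⟩ ds` (`setIntegral_fderiv_eq_integral_frontier`).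
It is proved without the area formula, by accepting an error and then removing it. Fix `ε > 0`. In
orthogonal coordinates `(y, t)` along the tangent plane and the normal `e` at a boundary point,
`Ω` is locally the subgraph of a `C¹` function `g` with `|∇g| ≤ ε` (`exists_boundary_graph`).
There Fubini gives `∫_Ω ∂ᵥ f` exactly as an integral over the tangent plane: `⟨v, e⟩ ∫ f(y, g y)
dy` plus a term of size `ε ∫ |f|`. On the other hand the parametrization `y ↦ (y, g y)` is
expanding and `(1 + ε)`-Lipschitz, so area and Lebesgue measure on the tangent plane agree up to
the factor `(1 + ε)^(m-1)`, and `n` differs from `e` by at most `ε`. Hence the identity holds for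
`f` supported near that point up to an error `ε' |v| ∫_∂Ω |f| ds`
(`exists_nhds_abs_integral_sub_le`). These errors add up correctly under decomposition of `f` by
cutoffs (`exists_isOpen_abs_fluxDefect_le`), so the global error is at most `ε' |v| ∫_∂Ω |f| ds`
for every `ε' > 0`, hence zero.
-/

open scoped NNReal

/-! ### Derivatives integrated over a subgraph -/

section Subgraph

/-- The vertical shear that straightens the graph of `g`. -/
def graphShear {X : Type*} [TopologicalSpace X] {g : X → ℝ} (hg : Continuous g) :
    X × ℝ ≃ₜ X × ℝ where
  toFun z := (z.1, z.2 + g z.1)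
  invFun z := (z.1, z.2 - g z.1)
  left_inv z := by simp
  right_inv z := by simp
  continuous_toFun := by fun_prop
  continuous_invFun := by fun_prop

theorem isClosedEmbedding_graph {X : Type*} [TopologicalSpace X] {g : X → ℝ}
    (hg : Continuous g) :
    Topology.IsClosedEmbedding fun y : X => (y, g y) := by
  have h : Topology.IsClosedEmbedding fun y : X => (y, (0 : ℝ)) :=
    Topology.IsClosedEmbedding.of_continuous_injective_isClosedMap
      (by fun_prop) (Prod.mk_left_injective 0) (isClosedMap_prodMk_right 0)
  simpa [Function.comp_def, graphShear] using (graphShear hg).isClosedEmbedding.comp h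

variable {K : Type*} [NormedAddCommGroup K] [InnerProductSpace ℝ K] [FiniteDimensional ℝ K]
  [MeasurableSpace K] [BorelSpace K]

theorem measurableSet_subgraph {X : Type*} [TopologicalSpace X] [MeasurableSpace X]
    [OpensMeasurableSpace (X × ℝ)] {g : X → ℝ} (hg : Continuous g) :
    MeasurableSet {z : X × ℝ | z.2 < g z.1} :=
  (isOpen_lt continuous_snd (hg.comp continuous_fst)).measurableSet

theorem setIntegral_subgraph {g : K → ℝ} (hg : Continuous g) {H : K × ℝ → ℝ}
    (hH : Integrable H) :
    ∫ z in {z : K × ℝ | z.2 < g z.1}, H z = ∫ y, ∫ t in Set.Iic (g y), H (y, t) := by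
  have hS := measurableSet_subgraph hg
  rw [← integral_indicator hS, Measure.volume_eq_prod, integral_prod _ (hH.indicator hS)]
  refine integral_congr_ae (.of_forall fun y => ?_)
  simp only
  rw [integral_Iic_eq_integral_Iio, ← integral_indicator measurableSet_Iio]
  rfl

/-- The fundamental theorem of calculus along each vertical line. -/
theorem setIntegral_subgraph_fderiv_vertical {g : K → ℝ} (hg : Continuous g) {F : K × ℝ → ℝ}
    (hF : ContDiff ℝ 1 F) (hFc : HasCompactSupport F) :
    ∫ z in {z : K × ℝ | z.2 < g z.1}, fderiv ℝ F z (0, 1) = ∫ y, F (y, g y) := by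
  have hH : Integrable fun z => fderiv ℝ F z (0, 1) :=
    ((hF.continuous_fderiv (by simp)).clm_apply continuous_const).integrable_of_hasCompactSupport
      (hFc.fderiv_apply ℝ (0, 1))
  rw [setIntegral_subgraph hg hH]
  refine integral_congr_ae (.of_forall fun y => ?_)
  simp only
  have hl : ContDiff ℝ 1 fun t : ℝ => F (y, t) := hF.comp (contDiff_prodMk_right y)
  have hc : HasCompactSupport fun t : ℝ => F (y, t) :=
    hFc.comp_isClosedEmbedding (Topology.IsClosedEmbedding.of_continuous_injective_isClosedMap
      (by fun_prop) (Prod.mk_right_injective y) (isClosedMap_prodMk_left y))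
  rw [← hc.integral_Iic_deriv_eq hl (g y)]
  refine setIntegral_congr_fun measurableSet_Iic fun t _ => ?_
  have h1 : HasDerivAt (fun t : ℝ => (y, t)) ((0 : K), (1 : ℝ)) t :=
    (hasDerivAt_const t y).prodMk (hasDerivAt_id t)
  exact ((hF.differentiable (by simp) _).hasFDerivAt.comp_hasDerivAt t h1).deriv.symm

/-- After the graph has been straightened by a shear, a horizontal derivative integrates to zero;
undoing the shear leaves the boundary term. -/
theorem setIntegral_subgraph_fderiv_horizontal {g : K → ℝ} (hg : ContDiff ℝ 1 g)
    {F : K × ℝ → ℝ} (hF : ContDiff ℝ 1 F) (hFc : HasCompactSupport F) (w : K) :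
    ∫ z in {z : K × ℝ | z.2 < g z.1}, fderiv ℝ F z (w, 0)
      = - ∫ y, F (y, g y) * fderiv ℝ g y w := by
  have hgc := hg.continuous
  set h : K × ℝ → ℝ := F ∘ graphShear hgc with hh
  have hsh : ContDiff ℝ 1 (graphShear hgc) :=
    contDiff_fst.prodMk (contDiff_snd.add (hg.comp contDiff_fst))
  have hhd : ContDiff ℝ 1 h := hF.comp hsh
  have hhc : HasCompactSupport h := hFc.comp_homeomorph _
  have hder : ∀ y s, fderiv ℝ h (y, s) (w, 0)
      = fderiv ℝ F (y, s + g y) (w, 0) + fderiv ℝ g y w * fderiv ℝ F (y, s + g y) (0, 1) := by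
    intro y s
    have h1 : HasFDerivAt (graphShear hgc) ((ContinuousLinearMap.fst ℝ K ℝ).prod
        (ContinuousLinearMap.snd ℝ K ℝ + (fderiv ℝ g y).comp (ContinuousLinearMap.fst ℝ K ℝ)))
        (y, s) :=
      hasFDerivAt_fst.prodMk (hasFDerivAt_snd.add
        ((hg.differentiable (by simp) y).hasFDerivAt.comp (y, s) hasFDerivAt_fst))
    have h2 := ((hF.differentiable (by simp) (graphShear hgc (y, s))).hasFDerivAt.comp
      (y, s) h1).fderiv
    rw [hh, h2]
    have h3 : (w, fderiv ℝ g y w) = (w, (0 : ℝ)) + fderiv ℝ g y w • ((0 : K), (1 : ℝ)) := by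
      simp
    have h4 : graphShear hgc (y, s) = (y, s + g y) := rfl
    simp only [ContinuousLinearMap.comp_apply, ContinuousLinearMap.prod_apply,
      ContinuousLinearMap.coe_fst', add_apply, ContinuousLinearMap.coe_snd',
      zero_add]
    rw [h3, map_add, map_smul, h4, smul_eq_mul]
  have hHint : Integrable fun z => fderiv ℝ h z (w, 0) :=
    ((hhd.continuous_fderiv (by simp)).clm_apply continuous_const).integrable_of_hasCompactSupport
      (hhc.fderiv_apply ℝ (w, 0))
  have hF1 : Continuous fun z => fderiv ℝ F z (w, 0) :=
    (hF.continuous_fderiv (by simp)).clm_apply continuous_const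
  have hF1c : HasCompactSupport fun z => fderiv ℝ F z (w, 0) := hFc.fderiv_apply ℝ (w, 0)
  have hF2 : Continuous fun z => fderiv ℝ F z (0, 1) :=
    (hF.continuous_fderiv (by simp)).clm_apply continuous_const
  have hF2c : HasCompactSupport fun z => fderiv ℝ F z (0, 1) := hFc.fderiv_apply ℝ (0, 1)
  have hline : ∀ y : K, Topology.IsClosedEmbedding fun t : ℝ => (y, t) := fun y =>
    Topology.IsClosedEmbedding.of_continuous_injective_isClosedMap
      (by fun_prop) (Prod.mk_right_injective y) (isClosedMap_prodMk_left y)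
  have hlineK : ∀ s : ℝ, Topology.IsClosedEmbedding fun y : K => (y, s) := fun s =>
    Topology.IsClosedEmbedding.of_continuous_injective_isClosedMap
      (by fun_prop) (Prod.mk_left_injective s) (isClosedMap_prodMk_right s)
  have hli : ∀ {H : K × ℝ → ℝ}, Continuous H → HasCompactSupport H → ∀ y,
      Integrable fun t : ℝ => H (y, t) := fun hH hHc y =>
    (hH.comp (by fun_prop : Continuous fun t : ℝ => (y, t))).integrable_of_hasCompactSupport
      (hHc.comp_isClosedEmbedding (hline y))
  -- the integral of the sheared derivative over the half space vanishes
  have hzero : ∫ y, ∫ s in Set.Iic (0 : ℝ), fderiv ℝ h (y, s) (w, 0) = 0 := by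
    have := integral_integral_swap (μ := (volume : Measure K))
      (ν := (volume : Measure ℝ).restrict (Set.Iic 0))
      (f := fun y s => fderiv ℝ h (y, s) (w, 0))
      (by
        rw [← Measure.restrict_univ (μ := (volume : Measure K)), Measure.prod_restrict]
        exact hHint.integrableOn)
    rw [this]
    refine integral_eq_zero_of_ae (.of_forall fun s => ?_)
    have hk : ContDiff ℝ 1 fun y : K => h (y, s) := hhd.comp (contDiff_prodMk_left s)
    have hkc : HasCompactSupport fun y : K => h (y, s) :=
      hhc.comp_isClosedEmbedding (hlineK s)
    have e : ∀ y, fderiv ℝ h (y, s) (w, 0) = fderiv ℝ (fun y : K => h (y, s)) y w := by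
      intro y
      have h1 : HasFDerivAt (fun y : K => (y, s)) (ContinuousLinearMap.inl ℝ K ℝ) y :=
        hasFDerivAt_prodMk_left y s
      have h2 := ((hhd.differentiable (by simp) (y, s)).hasFDerivAt.comp y h1).fderiv
      have h3 : fderiv ℝ (fun y : K => h (y, s)) y = _ := h2
      rw [h3]; simp
    simp only [e, Pi.zero_apply]
    have := integral_mul_fderiv_eq_neg_fderiv_mul_of_integrable (μ := (volume : Measure K))
      (f := fun _ : K => (1 : ℝ)) (g := fun y : K => h (y, s)) (v := w)
      (by simp)
      (by
        simp only [one_mul]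
        exact ((hk.continuous_fderiv (by simp)).clm_apply
          continuous_const).integrable_of_hasCompactSupport (hkc.fderiv_apply ℝ w))
      (by simpa using hk.continuous.integrable_of_hasCompactSupport hkc)
      (by simp) (fun y _ => hk.differentiable (by simp) y)
    simpa using this
  -- undo the shear on each vertical line
  have hinner : ∀ y, ∫ s in Set.Iic (0 : ℝ), fderiv ℝ h (y, s) (w, 0)
      = (∫ t in Set.Iic (g y), fderiv ℝ F (y, t) (w, 0)) + F (y, g y) * fderiv ℝ g y w := by
    intro y
    have htr : ∀ H : ℝ → ℝ, ∫ s in Set.Iic (0 : ℝ), H (s + g y) = ∫ t in Set.Iic (g y), H t := by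
      intro H
      have := (measurePreserving_add_right (volume : Measure ℝ) (g y)).setIntegral_preimage_emb
        (measurableEmbedding_addRight (g y)) H (Set.Iic (g y))
      simpa using this
    simp only [hder]
    rw [integral_add, integral_const_mul, htr fun t => fderiv ℝ F (y, t) (w, 0),
      htr fun t => fderiv ℝ F (y, t) (0, 1)]
    · congr 1
      have hl : ContDiff ℝ 1 fun t : ℝ => F (y, t) := hF.comp (contDiff_prodMk_right y)
      have hc : HasCompactSupport fun t : ℝ => F (y, t) := hFc.comp_isClosedEmbedding (hline y)
      rw [← hc.integral_Iic_deriv_eq hl (g y), mul_comm]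
      congr 1
      refine setIntegral_congr_fun measurableSet_Iic fun t _ => ?_
      have h1 : HasDerivAt (fun t : ℝ => (y, t)) ((0 : K), (1 : ℝ)) t :=
        (hasDerivAt_const t y).prodMk (hasDerivAt_id t)
      exact ((hF.differentiable (by simp) _).hasFDerivAt.comp_hasDerivAt t h1).deriv.symm
    · exact ((hli hF1 hF1c y).comp_add_right (g y)).integrableOn
    · exact (((hli hF2 hF2c y).comp_add_right (g y)).const_mul _).integrableOn
  have hcg : HasCompactSupport fun y : K => F (y, g y) :=
    hFc.comp_isClosedEmbedding (isClosedEmbedding_graph hgc)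
  have hb : Integrable fun y => F (y, g y) * fderiv ℝ g y w := by
    refine Continuous.integrable_of_hasCompactSupport ?_ hcg.mul_right
    exact (hF.continuous.comp (by fun_prop)).mul
      ((hg.continuous_fderiv (by simp)).clm_apply continuous_const)
  have ha : Integrable fun y => ∫ t in Set.Iic (g y), fderiv ℝ F (y, t) (w, 0) := by
    have hS := measurableSet_subgraph hgc
    have := (hF1.integrable_of_hasCompactSupport (μ := (volume : Measure K).prod volume)
      hF1c).indicator hS
    refine this.integral_prod_left.congr (.of_forall fun y => ?_)
    simp only
    rw [integral_Iic_eq_integral_Iio, ← integral_indicator measurableSet_Iio]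
    rfl
  simp only [hinner] at hzero
  rw [integral_add ha hb] at hzero
  rw [setIntegral_subgraph hgc (hF1.integrable_of_hasCompactSupport hF1c)]
  linarith

end Subgraph

/-! ### The Hausdorff measure of a nearly flat graph -/

/-- Integrals against two comparable measures are close. -/
theorem abs_integral_sub_le_of_measure_le {X : Type*} [MeasurableSpace X] {τ σ : Measure X}
    {c : ℝ≥0} (h₁ : τ ≤ σ) (h₂ : σ ≤ c • τ) {f : X → ℝ} (hf : Integrable f σ) :
    |∫ x, f x ∂σ - ∫ x, f x ∂τ| ≤ (c - 1) * ∫ x, |f x| ∂τ := by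
  have hfτ : Integrable f τ := hf.mono_measure h₁
  have key : ∀ g : X → ℝ, Integrable g σ → 0 ≤ g →
      0 ≤ ∫ x, g x ∂σ - ∫ x, g x ∂τ ∧ ∫ x, g x ∂σ - ∫ x, g x ∂τ ≤ (c - 1) * ∫ x, g x ∂τ := by
    intro g hg g0
    have i1 : ∫ x, g x ∂τ ≤ ∫ x, g x ∂σ := integral_mono_measure h₁ (.of_forall g0) hg
    have i2 : ∫ x, g x ∂σ ≤ ∫ x, g x ∂(c • τ) :=
      integral_mono_measure h₂ (.of_forall g0) ((hg.mono_measure h₁).smul_measure_nnreal)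
    rw [integral_smul_nnreal_measure, NNReal.smul_def, smul_eq_mul] at i2
    constructor <;> linarith
  obtain ⟨p1, p2⟩ := key (fun x => max (f x) 0) hf.pos_part fun x => le_max_right _ _
  obtain ⟨n1, n2⟩ := key (fun x => max (-f x) 0) hf.neg_part fun x => le_max_right _ _
  have hsplit : ∀ x, f x = max (f x) 0 - max (-f x) 0 := fun x => by
    rcases le_total (f x) 0 with h | h <;> simp [h]
  have habs : ∀ x, |f x| = max (f x) 0 + max (-f x) 0 := fun x => by
    rcases le_total (f x) 0 with h | h <;> simp [h, abs_of_nonneg, abs_of_nonpos]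
  have e1 : ∫ x, f x ∂σ = ∫ x, max (f x) 0 ∂σ - ∫ x, max (-f x) 0 ∂σ := by
    rw [← integral_sub hf.pos_part hf.neg_part]; simp only [← hsplit]
  have e2 : ∫ x, f x ∂τ = ∫ x, max (f x) 0 ∂τ - ∫ x, max (-f x) 0 ∂τ := by
    rw [← integral_sub hfτ.pos_part hfτ.neg_part]; simp only [← hsplit]
  have e3 : ∫ x, |f x| ∂τ = ∫ x, max (f x) 0 ∂τ + ∫ x, max (-f x) 0 ∂τ := by
    rw [← integral_add hfτ.pos_part hfτ.neg_part]; simp only [← habs]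
  rw [e1, e2, e3, abs_le]
  constructor <;> linarith

theorem LipschitzOnWith.euclideanHausdorffMeasure_image_le {X Y : Type*} [EMetricSpace X]
    [MeasurableSpace X] [BorelSpace X] [EMetricSpace Y] [MeasurableSpace Y] [BorelSpace Y]
    {f : X → Y} {s : Set X} {C : ℝ≥0} (h : LipschitzOnWith C f s) (d : ℕ) :
    (μHE[d] : Measure Y) (f '' s) ≤ (C : ENNReal) ^ d * (μHE[d] : Measure X) s := by
  simp only [Measure.euclideanHausdorffMeasure_def, Measure.smul_apply, ENNReal.smul_def,
    smul_eq_mul]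
  rw [mul_left_comm]
  gcongr
  simpa using h.hausdorffMeasure_image_le (d := d) (by positivity)

theorem AntilipschitzWith.le_euclideanHausdorffMeasure_image {X Y : Type*} [EMetricSpace X]
    [MeasurableSpace X] [BorelSpace X] [EMetricSpace Y] [MeasurableSpace Y] [BorelSpace Y]
    {f : X → Y} {C : ℝ≥0} (h : AntilipschitzWith C f) (d : ℕ) (s : Set X) :
    (μHE[d] : Measure X) s ≤ (C : ENNReal) ^ d * (μHE[d] : Measure Y) (f '' s) := by
  simp only [Measure.euclideanHausdorffMeasure_def, Measure.smul_apply, ENNReal.smul_def,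
    smul_eq_mul]
  rw [mul_left_comm]
  gcongr
  simpa using h.le_hausdorffMeasure_image (d := d) (by positivity) s

section Graph

variable {K E : Type*} [NormedAddCommGroup K] [InnerProductSpace ℝ K] [FiniteDimensional ℝ K]
  [MeasurableSpace K] [BorelSpace K] [NormedAddCommGroup E] [MeasurableSpace E] [BorelSpace E]
  {G : K → E} {B : Set K} {C : ℝ≥0}

/-- For an expanding parametrization, Lebesgue measure is at most the surface measure. -/
theorem map_restrict_le_euclideanHausdorffMeasure (hG : Continuous G) (hG' : AntilipschitzWith 1 G)
    {d : ℕ} (hd : Module.finrank ℝ K = d) :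
    ((volume : Measure K).restrict B).map G ≤ (μHE[d] : Measure E).restrict (G '' B) := by
  refine Measure.le_iff.2 fun s hs => ?_
  rw [Measure.map_apply hG.measurable hs, Measure.restrict_apply (hG.measurable hs),
    Measure.restrict_apply hs, ← InnerProductSpace.euclideanHausdorffMeasure_eq_volume, hd]
  refine (hG'.le_euclideanHausdorffMeasure_image d _).trans ?_
  simp only [ENNReal.coe_one, one_pow, one_mul]
  refine measure_mono ?_
  rw [Set.image_preimage_inter]

/-- For a `C`-Lipschitz parametrization of a `d`-dimensional surface, the surface measure is at
most `C ^ d` times Lebesgue measure. -/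
theorem euclideanHausdorffMeasure_le_map_restrict (hG : Continuous G) (hGC : LipschitzOnWith C G B)
    {d : ℕ} (hd : Module.finrank ℝ K = d) :
    (μHE[d] : Measure E).restrict (G '' B) ≤ (C ^ d) • ((volume : Measure K).restrict B).map G := by
  refine Measure.le_iff.2 fun s hs => ?_
  rw [Measure.smul_apply, Measure.map_apply hG.measurable hs,
    Measure.restrict_apply (hG.measurable hs),
    Measure.restrict_apply hs, ← InnerProductSpace.euclideanHausdorffMeasure_eq_volume, hd,
    ← Set.image_preimage_inter, ENNReal.smul_def, smul_eq_mul, ENNReal.coe_pow]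
  exact (hGC.mono Set.inter_subset_right).euclideanHausdorffMeasure_image_le d

end Graph

/-! ### Sublevel sets as subgraphs -/

/-- The implicit function theorem with signs: where `∂ₜ r > 0`, the sublevel set `{r < 0}` lies
below the graph of a function whose slope is as small as desired. The graph function is cut off
so as to be defined and `C¹` everywhere. -/
theorem exists_contDiff_graph_of_sublevel {K : Type*} [NormedAddCommGroup K]
    [InnerProductSpace ℝ K] [FiniteDimensional ℝ K] {r : K × ℝ → ℝ} (hr : ContDiff ℝ 1 r)
    (h0 : r 0 = 0) (hy : ∀ y, fderiv ℝ r 0 (y, 0) = 0) (ht : 0 < fderiv ℝ r 0 (0, 1))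
    {ε : ℝ} (hε : 0 < ε) :
    ∃ g : K → ℝ, ContDiff ℝ 1 g ∧ ∃ δ > 0, (∀ y ∈ Metric.ball (0 : K) δ, ‖fderiv ℝ g y‖ ≤ ε) ∧
      ∀ z ∈ Metric.ball (0 : K × ℝ) δ, (r z < 0 ↔ z.2 < g z.1) := by
  have hinv : (fderiv ℝ r 0 ∘L .inr ℝ K ℝ).IsInvertible := by
    refine ⟨ContinuousLinearEquiv.unitsEquivAut ℝ (Units.mk0 _ ht.ne'), ?_⟩
    ext
    simp
  have hcd : ContDiffAt ℝ 1 r (0 : K × ℝ) := hr.contDiffAt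
  set ψ := hcd.implicitFunction one_ne_zero hinv with hψ
  have hψ0 : ψ 0 = 0 := hcd.implicitFunction_apply_self one_ne_zero hinv
  have hψr : ∀ᶠ y in 𝓝 (0 : K), r (y, ψ y) = 0 := by
    have := hcd.eventually_apply_implicitFunction one_ne_zero hinv
    rwa [h0] at this
  have hψc : ContDiffAt ℝ 1 ψ 0 := hcd.contDiffAt_implicitFunction one_ne_zero hinv
  have hψd : fderiv ℝ ψ 0 = 0 := by
    have h1 := (hcd.hasStrictFDerivAt_implicitFunction one_ne_zero hinv).hasFDerivAt.fderiv
    have h2 : fderiv ℝ r 0 ∘L .inl ℝ K ℝ = 0 := by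
      ext y; simpa using hy y
    rw [h2] at h1
    simpa using h1
  have hsmall : ∀ᶠ y in 𝓝 (0 : K), ‖fderiv ℝ ψ y‖ < ε := by
    have hc : ContinuousAt (fun y => ‖fderiv ℝ ψ y‖) 0 :=
      ((hψc.fderiv_right (m := 0) (by simp)).continuousAt).norm
    refine hc.eventually (gt_mem_nhds ?_)
    simpa [hψd] using hε
  have hev : ∀ᶠ y in 𝓝 (0 : K), ContDiffAt ℝ 1 ψ y := hψc.eventually (by simp)
  obtain ⟨δ₀, hδ₀, hball⟩ := Metric.eventually_nhds_iff_ball.1 (hψr.and (hsmall.and hev))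
  -- cut off `ψ`, which is controlled only near `0`
  let χ : ContDiffBump (0 : K) := ⟨δ₀ / 4, δ₀ / 2, by positivity, by linarith⟩
  set g : K → ℝ := fun y => χ y * ψ y with hg
  have hgc : ContDiff ℝ 1 g := by
    refine (contMDiff_of_tsupport (I := modelWithCornersSelf ℝ K) (n := 1)
      (f := g) fun y hy => ContDiffAt.contMDiffAt ?_).contDiff
    have hyχ : y ∈ tsupport χ := tsupport_mul_subset_left hy
    rw [χ.tsupport_eq] at hyχ
    have : y ∈ Metric.ball (0 : K) δ₀ := Metric.closedBall_subset_ball (by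
      show δ₀ / 2 < δ₀; linarith) hyχ
    exact χ.contDiffAt.mul (hball y this).2.2
  have hgψ : ∀ y ∈ Metric.ball (0 : K) (δ₀ / 4), g =ᶠ[𝓝 y] ψ := by
    intro y hy
    filter_upwards [Metric.isOpen_ball.mem_nhds hy] with x hx
    have : χ x = 1 := χ.one_of_mem_closedBall (Metric.ball_subset_closedBall hx)
    simp [hg, this]
  have hpos : ∀ᶠ z in 𝓝 (0 : K × ℝ), 0 < fderiv ℝ r z (0, 1) := by
    have hc : Continuous fun z => fderiv ℝ r z (0, 1) :=
      (hr.continuous_fderiv (by simp)).clm_apply continuous_const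
    exact hc.continuousAt.eventually (lt_mem_nhds ht)
  obtain ⟨δ₁, hδ₁, hpos⟩ := Metric.eventually_nhds_iff_ball.1 hpos
  have hg0 : g 0 = 0 := by simp [hg, hψ0]
  have hgs : ∀ᶠ y in 𝓝 (0 : K), |g y| < δ₁ := by
    refine (hgc.continuous.abs.continuousAt (x := 0)).eventually (gt_mem_nhds ?_)
    simpa [hg0] using hδ₁
  obtain ⟨δ₂, hδ₂, hgs⟩ := Metric.eventually_nhds_iff_ball.1 hgs
  refine ⟨g, hgc, min (δ₀ / 4) (min δ₁ δ₂), by positivity, fun y hy => ?_, ?_⟩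
  · have hy' : y ∈ Metric.ball (0 : K) (δ₀ / 4) := Metric.ball_subset_ball (min_le_left _ _) hy
    rw [(hgψ y hy').fderiv_eq]
    exact (hball y (Metric.ball_subset_ball (by linarith) hy')).2.1.le
  · rintro ⟨y, t⟩ hz
    rw [← Prod.mk_zero_zero, ← ball_prod_same, Set.mem_prod] at hz
    obtain ⟨hy, ht⟩ := hz
    have hy0 : y ∈ Metric.ball (0 : K) (δ₀ / 4) := Metric.ball_subset_ball (min_le_left _ _) hy
    have hy1 : y ∈ Metric.ball (0 : K) δ₁ :=
      Metric.ball_subset_ball ((min_le_right _ _).trans (min_le_left _ _)) hy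
    have hy2 : y ∈ Metric.ball (0 : K) δ₂ :=
      Metric.ball_subset_ball ((min_le_right _ _).trans (min_le_right _ _)) hy
    have ht1 : t ∈ Set.Ioo (-δ₁) δ₁ := by
      have : t ∈ Metric.ball (0 : ℝ) δ₁ :=
        Metric.ball_subset_ball ((min_le_right _ _).trans (min_le_left _ _)) ht
      simpa [abs_lt] using this
    have hg1 : g y ∈ Set.Ioo (-δ₁) δ₁ := by simpa [abs_lt] using hgs y hy2
    -- on a vertical segment `r` increases through its zero at `g y`, which gives the sign
    have hmono : StrictMonoOn (fun s : ℝ => r (y, s)) (Set.Ioo (-δ₁) δ₁) := by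
      refine strictMonoOn_of_deriv_pos (convex_Ioo _ _)
        (hr.continuous.comp (by fun_prop)).continuousOn fun s hs => ?_
      rw [interior_Ioo] at hs
      have h1 : HasDerivAt (fun s : ℝ => (y, s)) ((0 : K), (1 : ℝ)) s :=
        (hasDerivAt_const s y).prodMk (hasDerivAt_id s)
      have h2 := ((hr.differentiable (by simp) (y, s)).hasFDerivAt.comp_hasDerivAt s h1).deriv
      have h3 : deriv (fun s : ℝ => r (y, s)) s = _ := h2
      rw [h3]
      refine hpos _ ?_
      rw [← Prod.mk_zero_zero, ← ball_prod_same, Set.mem_prod]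
      exact ⟨hy1, by simpa [abs_lt] using hs⟩
    have hz0 : r (y, g y) = 0 := by
      rw [(hgψ y hy0).self_of_nhds]
      exact (hball y (Metric.ball_subset_ball (by linarith) hy0)).1
    have := hmono.lt_iff_lt ht1 hg1
    simp only [hz0] at this
    exact this

theorem frontier_subgraph {X : Type*} [TopologicalSpace X] {g : X → ℝ} (hg : Continuous g) :
    frontier {z : X × ℝ | z.2 < g z.1} = {z | z.2 = g z.1} := by
  refine subset_antisymm (frontier_lt_subset_eq continuous_snd (hg.comp continuous_fst)) ?_
  rintro ⟨y, t⟩ (hz : t = g y)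
  have ho : IsOpen {z : X × ℝ | z.2 < g z.1} :=
    isOpen_lt continuous_snd (hg.comp continuous_fst)
  refine ⟨?_, fun h => ?_⟩
  · have h1 : t ∈ closure (Set.Iio (g y)) := by rw [closure_Iio]; exact hz.le
    have h2 : Set.MapsTo (fun s : ℝ => (y, s)) (Set.Iio (g y)) {z : X × ℝ | z.2 < g z.1} :=
      fun s hs => hs
    exact h2.closure (by fun_prop) h1
  · rw [ho.interior_eq] at h
    exact absurd hz (ne_of_lt h)

/-- The orthogonal splitting `E = eᗮ ⊕ ℝ e` for a unit vector `e`: `(y, t) ↦ y + t e`, an isometry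
for the Euclidean norm of the product. -/
noncomputable def normalFrame {E : Type*} [NormedAddCommGroup E] [InnerProductSpace ℝ E]
    [FiniteDimensional ℝ E] (e : E) (he : ‖e‖ = 1) :
    WithLp 2 ((ℝ ∙ e)ᗮ × ℝ) ≃ₗᵢ[ℝ] E :=
  LinearIsometry.toLinearIsometryEquiv
    { toFun := fun z => (z.fst : E) + z.snd • e
      map_add' := fun z w => by simp [add_smul]; abel
      map_smul' := fun c z => by simp [smul_smul]
      norm_map' := fun z => by
        have h1 : inner ℝ (z.fst : E) (z.snd • e) = 0 := by
          rw [inner_smul_right, real_inner_comm,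
            Submodule.mem_orthogonal_singleton_iff_inner_right.1 z.fst.2, mul_zero]
        have h2 := norm_add_sq_real (z.fst : E) (z.snd • e)
        rw [h1, norm_smul, he] at h2
        have h3 := WithLp.prod_norm_sq_eq_of_L2 z
        rw [← sq_eq_sq₀ (norm_nonneg _) (norm_nonneg _)]
        rw [h3, Real.norm_eq_abs, sq_abs]
        simp only [mul_one, Real.norm_eq_abs, sq_abs, mul_zero, add_zero] at h2
        exact h2 }
    (by
      have he0 : e ≠ 0 := by rintro rfl; simp at he
      have h1 := (ℝ ∙ e).finrank_add_finrank_orthogonal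
      rw [finrank_span_singleton he0] at h1
      rw [LinearEquiv.finrank_eq (WithLp.linearEquiv 2 ℝ ((ℝ ∙ e)ᗮ × ℝ)), Module.finrank_prod,
        Module.finrank_self]
      omega)

/-! ### The outward unit normal -/

theorem eventually_isLocalDefiningFunction {m : ℕ} {Ω : Set (Euc m)} {p : Euc m}
    {ρ : Euc m → ℝ} (h : IsLocalDefiningFunction Ω p ρ) :
    ∀ᶠ x in 𝓝 p, IsLocalDefiningFunction Ω x ρ := by
  have hc : Continuous (gradient ρ) :=
    (InnerProductSpace.toDual ℝ (Euc m)).symm.continuous.comp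
      (h.smooth.continuous_fderiv (by simp))
  filter_upwards [h.eventually_mem_iff.eventually_nhds,
    hc.continuousAt.eventually_ne h.gradient_ne_zero] with x h1 h2
  exact ⟨h.smooth, h1, h2⟩

theorem norm_outwardUnitNormal {m : ℕ} {Ω : Set (Euc m)} (hΩ : IsSmoothBoundedDomain Ω)
    {p : Euc m} (hp : p ∈ frontier Ω) : ‖outwardUnitNormal Ω p‖ = 1 := by
  obtain ⟨ρ, hρ⟩ := hΩ.smooth_boundary p hp
  rw [outwardUnitNormal_eq hΩ.isOpen hp hρ, norm_smul, norm_inv, norm_norm,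
    inv_mul_cancel₀ (norm_ne_zero_iff.2 hρ.gradient_ne_zero)]

theorem gradient_eq_norm_smul_outwardUnitNormal {m : ℕ} {Ω : Set (Euc m)} (hΩ : IsOpen Ω)
    {p : Euc m} (hp : p ∈ frontier Ω) {ρ : Euc m → ℝ} (h : IsLocalDefiningFunction Ω p ρ) :
    gradient ρ p = ‖gradient ρ p‖ • outwardUnitNormal Ω p := by
  rw [outwardUnitNormal_eq hΩ hp h, smul_smul,
    mul_inv_cancel₀ (norm_ne_zero_iff.2 h.gradient_ne_zero), one_smul]

/-- The normal varies continuously along the boundary. -/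
theorem eventually_norm_outwardUnitNormal_sub_le {m : ℕ} {Ω : Set (Euc m)}
    (hΩ : IsSmoothBoundedDomain Ω) {p : Euc m} (hp : p ∈ frontier Ω) {ε : ℝ} (hε : 0 < ε) :
    ∀ᶠ x in 𝓝 p, x ∈ frontier Ω → ‖outwardUnitNormal Ω x - outwardUnitNormal Ω p‖ ≤ ε := by
  obtain ⟨ρ, hρ⟩ := hΩ.smooth_boundary p hp
  have hc : Continuous (gradient ρ) :=
    (InnerProductSpace.toDual ℝ (Euc m)).symm.continuous.comp
      (hρ.smooth.continuous_fderiv (by simp))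
  have hn : ContinuousAt (fun x => ‖‖gradient ρ x‖⁻¹ • gradient ρ x - outwardUnitNormal Ω p‖) p :=
    (((hc.continuousAt.norm.inv₀ (norm_ne_zero_iff.2 hρ.gradient_ne_zero)).smul
      hc.continuousAt).sub continuousAt_const).norm
  have hsm : ∀ᶠ x in 𝓝 p, ‖‖gradient ρ x‖⁻¹ • gradient ρ x - outwardUnitNormal Ω p‖ < ε := by
    refine hn.eventually (gt_mem_nhds ?_)
    simpa [← outwardUnitNormal_eq hΩ.isOpen hp hρ] using hε
  filter_upwards [eventually_isLocalDefiningFunction hρ, hsm] with x h1 h2 hx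
  rw [outwardUnitNormal_eq hΩ.isOpen hx h1]
  exact h2.le

/-- The outward unit normal extends to a smooth vector field on the whole space: locally as a
normalized gradient, globally by a partition of unity. -/
theorem exists_contDiff_extension_outwardUnitNormal {m : ℕ} {Ω : Set (Euc m)}
    (hΩ : IsSmoothBoundedDomain Ω) :
    ∃ N : Euc m → Euc m, ContDiff ℝ ∞ N ∧ ∀ x ∈ frontier Ω, N x = outwardUnitNormal Ω x := by
  obtain ⟨N, hN⟩ := exists_contMDiffMap_forall_mem_convex_of_local
    (modelWithCornersSelf ℝ (Euc m)) (n := (⊤ : ℕ∞)) (F := Euc m)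
    (t := fun x => {y | x ∈ frontier Ω → y = outwardUnitNormal Ω x})
    (fun x => by
      by_cases hx : x ∈ frontier Ω
      · simp [hx, convex_singleton]
      · simp [hx, convex_univ])
    (fun p => by
      by_cases hp : p ∈ frontier Ω
      · obtain ⟨ρ, hρ⟩ := hΩ.smooth_boundary p hp
        have hg : ContDiff ℝ ∞ (gradient ρ) :=
          (InnerProductSpace.toDual ℝ (Euc m)).symm.contDiff.comp
            (hρ.smooth.fderiv_right (m := ∞) (by simp))
        refine ⟨_, eventually_isLocalDefiningFunction hρ,
          fun x => ‖gradient ρ x‖⁻¹ • gradient ρ x, ?_, fun y hy hyf =>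
            (outwardUnitNormal_eq hΩ.isOpen hyf hy).symm⟩
        refine ContDiffOn.contMDiffOn fun x hx => ContDiffAt.contDiffWithinAt ?_
        have hx0 : gradient ρ x ≠ 0 := IsLocalDefiningFunction.gradient_ne_zero hx
        exact ((hg.contDiffAt.norm ℝ hx0).inv (norm_ne_zero_iff.2 hx0)).smul hg.contDiffAt
      · exact ⟨(frontier Ω)ᶜ, isClosed_frontier.isOpen_compl.mem_nhds hp, fun _ => 0,
          contMDiffOn_const, fun y hy hyf => absurd hyf hy⟩)
  exact ⟨N, N.contMDiff.contDiff, hN⟩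

/-! ### The boundary as a graph over its tangent plane -/

/-- Near a boundary point `p`, and in coordinates `(y, t)` along the tangent plane and the outward
normal at `p`, the domain lies below a graph of small slope, and the normal is nearly vertical. -/
theorem exists_boundary_graph {m : ℕ} {Ω : Set (Euc m)} (hΩ : IsSmoothBoundedDomain Ω)
    {p : Euc m} (hp : p ∈ frontier Ω) {e : Euc m} (he : ‖e‖ = 1) (hep : outwardUnitNormal Ω p = e)
    {ε : ℝ} (hε : 0 < ε) :
    ∃ g : (ℝ ∙ e)ᗮ → ℝ, ContDiff ℝ 1 g ∧ ∃ δ > 0,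
      (∀ y ∈ Metric.ball 0 δ, ‖fderiv ℝ g y‖ ≤ ε) ∧ ∃ U : Set (Euc m), IsOpen U ∧ p ∈ U ∧
      ∀ z : (ℝ ∙ e)ᗮ × ℝ, p + normalFrame e he (WithLp.toLp 2 z) ∈ U →
        z.1 ∈ Metric.ball 0 δ ∧
        (p + normalFrame e he (WithLp.toLp 2 z) ∈ Ω ↔ z.2 < g z.1) ∧
        (p + normalFrame e he (WithLp.toLp 2 z) ∈ frontier Ω ↔ z.2 = g z.1) ∧
        (p + normalFrame e he (WithLp.toLp 2 z) ∈ frontier Ω →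
          ‖outwardUnitNormal Ω (p + normalFrame e he (WithLp.toLp 2 z)) - e‖ ≤ ε) := by
  obtain ⟨ρ, hρ⟩ := hΩ.smooth_boundary p hp
  have hgrad := gradient_eq_norm_smul_outwardUnitNormal hΩ.isOpen hp hρ
  have hevn := eventually_norm_outwardUnitNormal_sub_le hΩ hp hε
  rw [hep] at hgrad hevn
  let Λ : ((ℝ ∙ e)ᗮ × ℝ) ≃L[ℝ] Euc m :=
    (WithLp.prodContinuousLinearEquiv 2 ℝ (ℝ ∙ e)ᗮ ℝ).symm.trans
      (normalFrame e he).toContinuousLinearEquiv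
  have hΛ : ∀ z, Λ z = (z.1 : Euc m) + z.2 • e := fun z => rfl
  let Ψ : ((ℝ ∙ e)ᗮ × ℝ) ≃ₜ Euc m := Λ.toHomeomorph.trans (Homeomorph.addLeft p)
  have hΨ : ∀ z, Ψ z = p + normalFrame e he (WithLp.toLp 2 z) := fun z => rfl
  have hΨ' : ∀ z, Ψ z = p + Λ z := fun z => rfl
  have hΨ0 : Ψ 0 = p := by rw [hΨ', map_zero, add_zero]
  have hfd : ∀ z, fderiv ℝ (ρ ∘ Ψ) 0 z = ‖gradient ρ p‖ * z.2 := by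
    intro z
    have h1 : HasFDerivAt Ψ (Λ : ((ℝ ∙ e)ᗮ × ℝ) →L[ℝ] Euc m) 0 :=
      (Λ.hasFDerivAt (x := 0)).const_add p
    have h2 : HasFDerivAt ρ (InnerProductSpace.toDual ℝ (Euc m) (gradient ρ p)) (Ψ 0) := by
      rw [hΨ0]
      exact (hρ.smooth.differentiable (by simp) p).hasGradientAt.hasFDerivAt
    rw [(h2.comp 0 h1).fderiv]
    have h3 : inner ℝ e (z.1 : Euc m) = 0 :=
      Submodule.mem_orthogonal_singleton_iff_inner_right.1 z.1.2
    simp only [ContinuousLinearMap.comp_apply, ContinuousLinearEquiv.coe_coe, hΛ,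
      InnerProductSpace.toDual_apply_apply]
    rw [hgrad, inner_smul_left, inner_add_right, inner_smul_right, h3,
      real_inner_self_eq_norm_sq, he]
    simp [norm_smul, he]
  have hgp : 0 < ‖gradient ρ p‖ := norm_pos_iff.2 hρ.gradient_ne_zero
  obtain ⟨g, hg, δ, hδ, hgδ, hlt⟩ := exists_contDiff_graph_of_sublevel (r := ρ ∘ Ψ)
    ((hρ.smooth.of_le (by exact_mod_cast le_top)).comp (contDiff_const.add Λ.contDiff))
    (by simpa [hΨ0] using hρ.eq_zero hΩ.isOpen hp) (fun y => by rw [hfd]; simp)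
    (by rw [hfd]; simpa using hgp) hε
  obtain ⟨W, hWsub, hWo, hpW⟩ := eventually_nhds_iff.1 (hρ.eventually_mem_iff.and hevn)
  refine ⟨g, hg, δ, hδ, hgδ, W ∩ Ψ '' Metric.ball 0 δ,
    hWo.inter (Ψ.isOpenMap _ Metric.isOpen_ball),
    ⟨hpW, 0, Metric.mem_ball_self hδ, hΨ0⟩, ?_⟩
  have hmemU : ∀ z, Ψ z ∈ W ∩ Ψ '' Metric.ball 0 δ ↔ Ψ z ∈ W ∧ z ∈ Metric.ball 0 δ := fun z => by
    rw [Set.mem_inter_iff, Ψ.injective.mem_set_image]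
  have hΩiff : ∀ z, Ψ z ∈ W ∩ Ψ '' Metric.ball 0 δ → (Ψ z ∈ Ω ↔ z.2 < g z.1) := fun z hz => by
    rw [hmemU] at hz
    rw [(hWsub _ hz.1).1]
    exact hlt z hz.2
  intro z hz
  rw [← hΨ] at hz ⊢
  refine ⟨?_, hΩiff z hz, ?_, (hWsub _ hz.1).2⟩
  · have := ((hmemU z).1 hz).2
    rw [← Prod.mk_zero_zero, ← ball_prod_same, Set.mem_prod] at this
    exact this.1
  · set V := Ψ ⁻¹' (W ∩ Ψ '' Metric.ball 0 δ) with hV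
    have hVo : IsOpen V := (hWo.inter (Ψ.isOpenMap _ Metric.isOpen_ball)).preimage Ψ.continuous
    have hzV : z ∈ V := hz
    have e1 : Ψ ⁻¹' Ω ∩ V = {z | z.2 < g z.1} ∩ V := by
      ext w
      exact and_congr_left fun hw => hΩiff w hw
    have e2 := frontier_inter_open_inter (s := Ψ ⁻¹' Ω) hVo
    rw [e1, frontier_inter_open_inter hVo, frontier_subgraph hg.continuous,
      ← Ψ.preimage_frontier] at e2
    have := Set.ext_iff.1 e2 z
    simp only [Set.mem_inter_iff, hzV, and_true] at this
    exact this.symm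

/-! ### The divergence theorem near a boundary point, up to a small error -/

section NormalFrame

variable {E : Type*} [NormedAddCommGroup E] [InnerProductSpace ℝ E] [FiniteDimensional ℝ E]

theorem normalFrame_apply {e : E} (he : ‖e‖ = 1) (z : WithLp 2 ((ℝ ∙ e)ᗮ × ℝ)) :
    normalFrame e he z = z.fst + z.snd • e := rfl

/-- The affine coordinates `(y, t) ↦ p + y + t e` of the orthogonal splitting, on the product with
its usual (sup norm) structure. -/
noncomputable def normalChart (p : E) {e : E} (he : ‖e‖ = 1) : ((ℝ ∙ e)ᗮ × ℝ) ≃ₜ E :=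
  ((WithLp.prodContinuousLinearEquiv 2 ℝ (ℝ ∙ e)ᗮ ℝ).symm.trans
      (normalFrame e he).toContinuousLinearEquiv).toHomeomorph.trans (Homeomorph.addLeft p)

theorem normalChart_eq_normalFrame (p : E) {e : E} (he : ‖e‖ = 1) (z : (ℝ ∙ e)ᗮ × ℝ) :
    normalChart p he z = p + normalFrame e he (WithLp.toLp 2 z) := rfl

theorem hasFDerivAt_normalChart (p : E) {e : E} (he : ‖e‖ = 1) (z : (ℝ ∙ e)ᗮ × ℝ) :
    HasFDerivAt (normalChart p he)
      (((WithLp.prodContinuousLinearEquiv 2 ℝ (ℝ ∙ e)ᗮ ℝ).symm.trans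
      (normalFrame e he).toContinuousLinearEquiv : ((ℝ ∙ e)ᗮ × ℝ) ≃L[ℝ] E) :
        ((ℝ ∙ e)ᗮ × ℝ) →L[ℝ] E) z :=
  (((WithLp.prodContinuousLinearEquiv 2 ℝ (ℝ ∙ e)ᗮ ℝ).symm.trans
    (normalFrame e he).toContinuousLinearEquiv).hasFDerivAt (x := z)).const_add p

theorem contDiff_normalChart (p : E) {e : E} (he : ‖e‖ = 1) {n : ℕ∞ω} :
    ContDiff ℝ n (normalChart p he) :=
  contDiff_const.add ((WithLp.prodContinuousLinearEquiv 2 ℝ (ℝ ∙ e)ᗮ ℝ).symm.trans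
      (normalFrame e he).toContinuousLinearEquiv).contDiff

theorem dist_normalChart_sq (p : E) {e : E} (he : ‖e‖ = 1) (z w : (ℝ ∙ e)ᗮ × ℝ) :
    dist (normalChart p he z) (normalChart p he w) ^ 2
      = ‖z.1 - w.1‖ ^ 2 + (z.2 - w.2) ^ 2 := by
  rw [normalChart_eq_normalFrame, normalChart_eq_normalFrame, dist_add_left,
    (normalFrame e he).dist_map, dist_eq_norm, WithLp.prod_norm_sq_eq_of_L2]
  simp

theorem measurePreserving_normalChart [MeasurableSpace E] [BorelSpace E] (p : E) {e : E}
    (he : ‖e‖ = 1) : MeasurePreserving (normalChart p he) :=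
  (measurePreserving_add_left volume p).comp
    ((normalFrame e he).measurePreserving.comp (WithLp.volume_preserving_toLp _ _))

theorem finrank_orthogonal_unit {e : E} (he : ‖e‖ = 1) :
    Module.finrank ℝ (ℝ ∙ e)ᗮ = Module.finrank ℝ E - 1 := by
  have he0 : e ≠ 0 := by rintro rfl; simp at he
  have h1 := (ℝ ∙ e).finrank_add_finrank_orthogonal
  rw [finrank_span_singleton he0] at h1
  omega

end NormalFrame

/-- The integral over a set depends only on the part of the set where the function lives. -/
theorem setIntegral_congr_of_support {X : Type*} [MeasurableSpace X] {μ : Measure X} {s t u : Set X}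
    (hs : MeasurableSet s) (ht : MeasurableSet t) (h : ∀ x ∈ u, (x ∈ s ↔ x ∈ t)) {f : X → ℝ}
    (hf : ∀ x ∉ u, f x = 0) : ∫ x in s, f x ∂μ = ∫ x in t, f x ∂μ := by
  rw [← integral_indicator hs, ← integral_indicator ht]
  refine integral_congr_ae (.of_forall fun x => ?_)
  by_cases hx : x ∈ u
  · by_cases hxs : x ∈ s
    · rw [Set.indicator_of_mem hxs, Set.indicator_of_mem ((h x hx).1 hxs)]
    · rw [Set.indicator_of_notMem hxs, Set.indicator_of_notMem (mt (h x hx).2 hxs)]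
  · exact (Set.indicator_apply_eq_zero.2 fun _ => hf x hx).trans
      (Set.indicator_apply_eq_zero.2 fun _ => hf x hx).symm

/-- Near a boundary point, the identity `∫_Ω ∂ᵥ f = ∫_∂Ω f ⟨v, n⟩` holds up to a relative error
`ε`. In coordinates adapted to the tangent plane the left side is computed exactly by Fubini; on
the right side the surface measure is replaced by Lebesgue measure on the tangent plane, and the
normal by its value at `p`, at the cost of a small factor. -/
theorem exists_nhds_abs_integral_sub_le {m : ℕ} {Ω : Set (Euc m)}
    (hΩ : IsSmoothBoundedDomain Ω) {N : Euc m → Euc m} (hNc : Continuous N)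
    (hN : ∀ x ∈ frontier Ω, N x = outwardUnitNormal Ω x) {p : Euc m} (hp : p ∈ frontier Ω)
    {ε : ℝ} (hε : 0 < ε) :
    ∃ U : Set (Euc m), IsOpen U ∧ p ∈ U ∧ (μHE[m - 1] : Measure (Euc m)) (frontier Ω ∩ U) < ⊤ ∧
      ∀ f : Euc m → ℝ, ContDiff ℝ 1 f → HasCompactSupport f → tsupport f ⊆ U → ∀ v : Euc m,
        |(∫ x in Ω, fderiv ℝ f x v) - ∫ x in frontier Ω, f x * inner ℝ v (N x) ∂μHE[m - 1]|
          ≤ ε * ‖v‖ * ∫ x in frontier Ω, |f x| ∂μHE[m - 1] := by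
  -- `(1 + η) ^ (m - 1) - 1` pays for replacing area by Lebesgue measure, one `η` for the slope of
  -- the graph, the other for the variation of the normal
  obtain ⟨η, hη, hηε⟩ : ∃ η : ℝ≥0, 0 < η ∧ (1 + (η : ℝ)) ^ (m - 1) - 1 + 2 * η < ε := by
    have hc : Continuous fun x : ℝ => (1 + x) ^ (m - 1) - 1 + 2 * x := by fun_prop
    have h0 : ∀ᶠ x in 𝓝 (0 : ℝ), (1 + x) ^ (m - 1) - 1 + 2 * x < ε :=
      hc.continuousAt.eventually (gt_mem_nhds (by simpa using hε))
    obtain ⟨δ, hδ, h⟩ := Metric.eventually_nhds_iff.1 h0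
    refine ⟨⟨δ / 2, by positivity⟩, ?_, h ?_⟩
    · exact half_pos hδ
    · rw [Real.dist_eq, sub_zero]
      change |δ / 2| < δ
      rw [abs_of_pos (half_pos hδ)]; linarith
  obtain ⟨e, hep⟩ : ∃ e, outwardUnitNormal Ω p = e := ⟨_, rfl⟩
  have he : ‖e‖ = 1 := hep ▸ norm_outwardUnitNormal hΩ hp
  obtain ⟨g, hg, δ, hδ, hgδ, U, hUo, hpU, hU⟩ := exists_boundary_graph hΩ hp he hep
    (NNReal.coe_pos.2 hη)
  simp only [← normalChart_eq_normalFrame] at hU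
  set Ψ := normalChart p he with hΨ
  set B : Set (ℝ ∙ e)ᗮ := Metric.ball 0 δ with hB
  set G : (ℝ ∙ e)ᗮ → Euc m := fun y => Ψ (y, g y) with hG
  set d := m - 1 with hd
  have hK : Module.finrank ℝ (ℝ ∙ e)ᗮ = d := by rw [finrank_orthogonal_unit he]; simp [hd]
  have hGc : Continuous G := Ψ.continuous.comp (continuous_id.prodMk hg.continuous)
  -- Pythagoras makes `G` expanding, and `(1 + η)`-Lipschitz over `B`
  have hGsq : ∀ y y', dist (G y) (G y') ^ 2 = ‖y - y'‖ ^ 2 + (g y - g y') ^ 2 := fun y y' =>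
    dist_normalChart_sq p he _ _
  have hGanti : AntilipschitzWith 1 G := by
    refine AntilipschitzWith.of_le_mul_dist fun y y' => ?_
    rw [NNReal.coe_one, one_mul, dist_eq_norm, ← sq_le_sq₀ (norm_nonneg _) dist_nonneg, hGsq]
    nlinarith [sq_nonneg (g y - g y')]
  have hGlip : LipschitzOnWith (1 + η) G B := by
    refine LipschitzOnWith.of_dist_le_mul fun y hy y' hy' => ?_
    have h1 : ‖g y - g y'‖ ≤ η * ‖y - y'‖ :=
      (convex_ball (0 : (ℝ ∙ e)ᗮ) δ).norm_image_sub_le_of_norm_fderiv_le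
        (fun x _ => hg.differentiable (by simp) x) hgδ hy' hy
    rw [dist_eq_norm y y', ← sq_le_sq₀ dist_nonneg (by positivity), hGsq, NNReal.coe_add,
      NNReal.coe_one]
    rw [Real.norm_eq_abs] at h1
    have h2 : (g y - g y') ^ 2 ≤ (η * ‖y - y'‖) ^ 2 := by
      rw [← sq_abs]; gcongr
    nlinarith [mul_nonneg η.2 (sq_nonneg ‖y - y'‖)]
  have hBm : MeasurableSet B := Metric.isOpen_ball.measurableSet
  have hGBm : MeasurableSet (G '' B) :=
    hBm.image_of_continuousOn_injOn hGc.continuousOn hGanti.injective.injOn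
  set τ := ((volume : Measure (ℝ ∙ e)ᗮ).restrict B).map G with hτ
  set σ := (μHE[d] : Measure (Euc m)).restrict (G '' B) with hσ
  have hτσ : τ ≤ σ := map_restrict_le_euclideanHausdorffMeasure hGc hGanti hK
  have hστ : σ ≤ ((1 + η) ^ d) • τ := euclideanHausdorffMeasure_le_map_restrict hGc hGlip hK
  have hBfin : IsFiniteMeasure ((volume : Measure (ℝ ∙ e)ᗮ).restrict B) :=
    ⟨by rw [Measure.restrict_apply_univ]; exact measure_ball_lt_top⟩
  have hσfin : IsFiniteMeasure σ := isFiniteMeasure_of_le _ hστ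
  -- inside `U`, the boundary is the graph
  have hUG : ∀ x ∈ U, (x ∈ frontier Ω ↔ x ∈ G '' B) := by
    intro x hx
    obtain ⟨z, rfl⟩ := Ψ.surjective x
    obtain ⟨z1, -, z3, -⟩ := hU z hx
    rw [z3]
    constructor
    · intro h
      exact ⟨z.1, z1, by rw [hG]; simp only [← h]⟩
    · rintro ⟨y, -, hyz⟩
      have := Ψ.injective hyz
      rw [← this]
  refine ⟨U, hUo, hpU, ?_, fun f hf hfc hfU v => ?_⟩
  · calc (μHE[d] : Measure (Euc m)) (frontier Ω ∩ U)
        ≤ (μHE[d] : Measure (Euc m)) (G '' B) :=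
          measure_mono fun x hx => (hUG x hx.2).1 hx.1
      _ = σ Set.univ := by rw [hσ, Measure.restrict_apply_univ]
      _ < ⊤ := measure_lt_top _ _
  have hf0 : ∀ x ∉ U, f x = 0 := fun x hx => image_eq_zero_of_notMem_tsupport fun h => hx (hfU h)
  have hfd0 : ∀ x ∉ U, fderiv ℝ f x = 0 := fun x hx =>
    image_eq_zero_of_notMem_tsupport fun h => hx (hfU (tsupport_fderiv_subset ℝ h))
  -- the components of `v`
  obtain ⟨⟨w, s⟩, hws⟩ : ∃ z : (ℝ ∙ e)ᗮ × ℝ, normalFrame e he (WithLp.toLp 2 z) = v :=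
    ⟨((normalFrame e he).symm v).ofLp, by simp⟩
  have hvsq : ‖v‖ ^ 2 = ‖w‖ ^ 2 + s ^ 2 := by
    rw [← hws, (normalFrame e he).norm_map, WithLp.prod_norm_sq_eq_of_L2]
    simp
  have hw : ‖w‖ ≤ ‖v‖ := by
    rw [← sq_le_sq₀ (norm_nonneg _) (norm_nonneg _)]; nlinarith [sq_nonneg s]
  have hs : |s| ≤ ‖v‖ := by
    rw [← sq_le_sq₀ (abs_nonneg _) (norm_nonneg _), sq_abs]; nlinarith [sq_nonneg ‖w‖]
  have hsv : inner ℝ v e = s := by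
    rw [← hws, normalFrame_apply, inner_add_left, inner_smul_left, real_inner_self_eq_norm_sq, he]
    simp [show inner ℝ (w : Euc m) e = 0 from
        Submodule.mem_orthogonal_singleton_iff_inner_left.1 w.2]
  -- the left side in coordinates
  set F : (ℝ ∙ e)ᗮ × ℝ → ℝ := f ∘ Ψ with hF
  have hFd : ContDiff ℝ 1 F := hf.comp (contDiff_normalChart p he)
  have hFc : HasCompactSupport F := hfc.comp_homeomorph Ψ
  have hFder : ∀ z, fderiv ℝ f (Ψ z) v = fderiv ℝ F z (w, s) := by
    intro z
    have h1 := ((hf.differentiable (by simp) (Ψ z)).hasFDerivAt.comp z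
      (hasFDerivAt_normalChart p he z)).fderiv
    rw [hF, h1, ← hws]
    rfl
  have hFint : ∀ a : (ℝ ∙ e)ᗮ × ℝ, Integrable fun z => fderiv ℝ F z a := fun a =>
    ((hFd.continuous_fderiv (by simp)).clm_apply continuous_const).integrable_of_hasCompactSupport
      (hFc.fderiv_apply ℝ a)
  have hleft : ∫ x in Ω, fderiv ℝ f x v
      = (s * ∫ y, F (y, g y)) - ∫ y, F (y, g y) * fderiv ℝ g y w := by
    rw [← (measurePreserving_normalChart p he).setIntegral_preimage_emb
      (normalChart p he).measurableEmbedding]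
    simp only [← hΨ, hFder]
    rw [setIntegral_congr_of_support (μ := volume) (u := Ψ ⁻¹' U)
      (t := {z : (ℝ ∙ e)ᗮ × ℝ | z.2 < g z.1})
      (Ψ.continuous.measurable hΩ.isOpen.measurableSet) (measurableSet_subgraph hg.continuous)
      (fun z hz => (hU z hz).2.1) (f := fun z => fderiv ℝ F z (w, s))
      (fun z hz => by rw [← hFder, hfd0 _ hz]; rfl)]
    have hdec : ∀ z, fderiv ℝ F z (w, s) = s * fderiv ℝ F z (0, 1) + fderiv ℝ F z (w, 0) := by
      intro z
      rw [← smul_eq_mul, ← map_smul, ← map_add]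
      simp
    simp only [hdec]
    rw [integral_add ((hFint _).const_mul s).integrableOn (hFint _).integrableOn,
      integral_const_mul, setIntegral_subgraph_fderiv_vertical hg.continuous hFd hFc,
      setIntegral_subgraph_fderiv_horizontal hg hFd hFc, sub_eq_add_neg]
  -- integrals over the tangent plane and over the boundary, for functions supported in `U`
  have hτint : ∀ h : Euc m → ℝ, Continuous h → (∀ x ∉ U, h x = 0) →
      ∫ x, h x ∂τ = ∫ y, h (G y) := by
    intro h hh h0
    rw [hτ, integral_map hGc.aemeasurable hh.aestronglyMeasurable]
    refine setIntegral_eq_integral_of_forall_compl_eq_zero fun y hy => ?_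
    refine h0 _ fun hGy => hy ?_
    exact (hU (y, g y) hGy).1
  have hσint : ∀ h : Euc m → ℝ, (∀ x ∉ U, h x = 0) →
      ∫ x in frontier Ω, h x ∂μHE[d] = ∫ x, h x ∂σ := fun h h0 =>
    setIntegral_congr_of_support isClosed_frontier.measurableSet hGBm hUG h0
  have hfσ : Integrable f σ := hf.continuous.integrable_of_hasCompactSupport hfc
  have e1 : ∫ x, f x ∂τ = ∫ y, F (y, g y) := hτint f hf.continuous hf0
  have e2 : ∫ x, |f x| ∂τ = ∫ y, |F (y, g y)| :=
    hτint (fun x => |f x|) hf.continuous.abs fun x hx => by simp [hf0 x hx]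
  have e3 := hσint (fun x => |f x|) fun x hx => by simp [hf0 x hx]
  have e4 := hσint (fun x => f x * inner ℝ v (N x)) fun x hx => by simp [hf0 x hx]
  have hc2 : ∫ x, |f x| ∂τ ≤ ∫ x, |f x| ∂σ :=
    integral_mono_measure hτσ (.of_forall fun x => abs_nonneg _) hfσ.abs
  have hab : |∫ x, f x ∂σ - ∫ x, f x ∂τ| ≤ ((1 + (η : ℝ)) ^ d - 1) * ∫ x, |f x| ∂τ := by
    simpa using abs_integral_sub_le_of_measure_le hτσ hστ hfσ
  have hP : |∫ y, F (y, g y) * fderiv ℝ g y w| ≤ η * ‖v‖ * ∫ x, |f x| ∂τ := by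
    rw [e2, ← integral_const_mul, ← Real.norm_eq_abs]
    refine norm_integral_le_of_norm_le ?_ (.of_forall fun y => ?_)
    · refine Integrable.const_mul ?_ _
      have h1 : Integrable (fun y => f (G y)) := by
        refine (hf.continuous.comp hGc).integrable_of_hasCompactSupport ?_
        exact hfc.comp_isClosedEmbedding
          (Ψ.isClosedEmbedding.comp (isClosedEmbedding_graph hg.continuous))
      exact h1.abs
    · rw [Real.norm_eq_abs, abs_mul]
      by_cases hy : G y ∈ U
      · have h1 := (fderiv ℝ g y).le_opNorm w
        have h2 := hgδ y (hU (y, g y) hy).1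
        rw [Real.norm_eq_abs] at h1
        have h3 : |fderiv ℝ g y w| ≤ η * ‖v‖ := h1.trans (by gcongr)
        rw [mul_comm]
        gcongr
      · have : F (y, g y) = 0 := hf0 _ hy
        simp [this]
  have hNint : Integrable (fun x => f x * inner ℝ v (N x)) σ :=
    (hf.continuous.mul (continuous_const.inner hNc)).integrable_of_hasCompactSupport hfc.mul_right
  have hQ : |∫ x, f x * inner ℝ v (N x) ∂σ - s * ∫ x, f x ∂σ| ≤ η * ‖v‖ * ∫ x, |f x| ∂σ := by
    rw [← integral_const_mul, ← integral_sub hNint (hfσ.const_mul s), ← integral_const_mul,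
      ← Real.norm_eq_abs]
    refine norm_integral_le_of_norm_le (hfσ.abs.const_mul _) ?_
    refine (ae_restrict_iff' hGBm).2 (.of_forall fun x hx => ?_)
    have h1 : f x * inner ℝ v (N x) - s * f x = f x * inner ℝ v (N x - e) := by
      rw [inner_sub_right, hsv]; ring
    rw [h1, Real.norm_eq_abs, abs_mul]
    by_cases hxU : x ∈ U
    · have hxf := (hUG x hxU).2 hx
      have h2 : ‖N x - e‖ ≤ η := by
        obtain ⟨z, rfl⟩ := Ψ.surjective x
        rw [hN _ hxf]
        exact (hU z hxU).2.2.2 hxf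
      have h3 : |inner ℝ v (N x - e)| ≤ η * ‖v‖ := by
        refine (abs_real_inner_le_norm _ _).trans ?_
        rw [mul_comm]
        gcongr
      rw [mul_comm]
      gcongr
    · simp [hf0 x hxU]
  rw [hleft, e3, e4, ← e1]
  have hone : 0 ≤ (1 + (η : ℝ)) ^ d - 1 := by
    have := one_le_pow₀ (n := d) (show (1 : ℝ) ≤ 1 + η by simp)
    linarith
  have hab' : |s * (∫ x, f x ∂τ - ∫ x, f x ∂σ)|
      ≤ ‖v‖ * (((1 + (η : ℝ)) ^ d - 1) * ∫ x, |f x| ∂σ) := by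
    rw [abs_mul, abs_sub_comm]
    refine mul_le_mul hs (hab.trans ?_) (abs_nonneg _) (norm_nonneg _)
    gcongr
  have hP' : |∫ y, F (y, g y) * fderiv ℝ g y w| ≤ η * ‖v‖ * ∫ x, |f x| ∂σ :=
    hP.trans (by gcongr)
  have hfin : ‖v‖ * ((1 + (η : ℝ)) ^ d - 1 + 2 * η) * ∫ x, |f x| ∂σ
      ≤ ε * ‖v‖ * ∫ x, |f x| ∂σ := by
    rw [mul_comm ε]
    gcongr
  refine le_trans ?_ hfin
  have hsum : s * ∫ x, f x ∂τ - (∫ y, F (y, g y) * fderiv ℝ g y w)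
        - ∫ x, f x * inner ℝ v (N x) ∂σ
      = s * (∫ x, f x ∂τ - ∫ x, f x ∂σ) - (∫ y, F (y, g y) * fderiv ℝ g y w)
        - (∫ x, f x * inner ℝ v (N x) ∂σ - s * ∫ x, f x ∂σ) := by ring
  rw [hsum]
  refine (abs_sub _ _).trans ((add_le_add ((abs_sub _ _).trans (add_le_add hab' hP')) hQ).trans ?_)
  exact le_of_eq (by ring)

/-! ### The divergence theorem -/

theorem measure_frontier_lt_top {m : ℕ} {Ω : Set (Euc m)} (hΩ : IsSmoothBoundedDomain Ω) :
    (μHE[m - 1] : Measure (Euc m)) (frontier Ω) < ⊤ := by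
  obtain ⟨N, hN, hNn⟩ := exists_contDiff_extension_outwardUnitNormal hΩ
  have hc : IsCompact (frontier Ω) :=
    hΩ.isBounded.isCompact_closure.of_isClosed_subset isClosed_frontier frontier_subset_closure
  refine hc.measure_lt_top_of_nhdsWithin fun p hp => ?_
  obtain ⟨U, hUo, hpU, hU, -⟩ :=
    exists_nhds_abs_integral_sub_le hΩ hN.continuous hNn hp one_pos
  exact ⟨frontier Ω ∩ U, inter_mem_nhdsWithin _ (hUo.mem_nhds hpU), hU⟩

/-- A set of finite `(m - 1)`-dimensional measure is null in dimension `m`. In dimension `0` the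
truncated subtraction makes this argument void, but there the boundary is empty. -/
theorem volume_frontier_eq_zero {m : ℕ} {Ω : Set (Euc m)} (hΩ : IsSmoothBoundedDomain Ω) :
    volume (frontier Ω) = 0 := by
  rcases Nat.eq_zero_or_pos m with rfl | hm
  · have : Ω = Set.univ := Subsingleton.eq_univ_of_nonempty hΩ.isConnected.nonempty
    simp [this]
  · rw [← EuclideanSpace.euclideanHausdorffMeasure_eq_volume]
    exact (Measure.euclideanHausdorffMeasure_zero_or_top (Nat.sub_one_lt hm.ne')
      (frontier Ω)).resolve_right (measure_frontier_lt_top hΩ).ne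

theorem exists_contDiff_one_nhds_of_isCompact {E : Type*} [NormedAddCommGroup E]
    [NormedSpace ℝ E] [FiniteDimensional ℝ E] {A U : Set E} (hA : IsCompact A) (hU : IsOpen U)
    (hAU : A ⊆ U) :
    ∃ χ : E → ℝ, ContDiff ℝ ∞ χ ∧ HasCompactSupport χ ∧ tsupport χ ⊆ U ∧
      (∀ᶠ x in 𝓝ˢ A, χ x = 1) ∧ ∀ x, χ x ∈ Set.Icc (0 : ℝ) 1 := by
  obtain ⟨L, hL, hAL, hLU⟩ := exists_compact_between hA hU hAU
  obtain ⟨χ, h1, h2, h3⟩ := exists_contMDiffMap_one_nhds_of_subset_interior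
    (n := (⊤ : ℕ∞)) (modelWithCornersSelf ℝ E) hA.isClosed hAL
  have hs : tsupport χ ⊆ L := by
    refine closure_minimal (fun x hx => ?_) hL.isClosed
    by_contra hxL
    exact hx (h2 x hxL)
  exact ⟨χ, χ.contMDiff.contDiff, hL.of_isClosed_subset (isClosed_tsupport _) hs, hs.trans hLU,
    h1, h3⟩

/-- The amount by which the identity `∫_Ω ∂ᵥ f = ∫_∂Ω f ⟨v, N⟩` fails. The field `N` stands for an
extension of the outward unit normal to the whole space. -/
noncomputable def fluxDefect {m : ℕ} (Ω : Set (Euc m)) (N : Euc m → Euc m) (v : Euc m)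
    (f : Euc m → ℝ) : ℝ :=
  (∫ x in Ω, fderiv ℝ f x v) - ∫ x in frontier Ω, f x * inner ℝ v (N x) ∂μHE[m - 1]

theorem fluxDefect_add {m : ℕ} {Ω : Set (Euc m)} (hΩ : IsSmoothBoundedDomain Ω)
    {N : Euc m → Euc m} (hN : Continuous N) (v : Euc m) {f₁ f₂ : Euc m → ℝ}
    (h₁ : ContDiff ℝ 1 f₁) (h₂ : ContDiff ℝ 1 f₂) (c₁ : HasCompactSupport f₁)
    (c₂ : HasCompactSupport f₂) :
    fluxDefect Ω N v (fun x => f₁ x + f₂ x) = fluxDefect Ω N v f₁ + fluxDefect Ω N v f₂ := by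
  have hfin : IsFiniteMeasure ((μHE[m - 1] : Measure (Euc m)).restrict (frontier Ω)) :=
    ⟨by rw [Measure.restrict_apply_univ]; exact measure_frontier_lt_top hΩ⟩
  have hd : ∀ {f : Euc m → ℝ}, ContDiff ℝ 1 f → HasCompactSupport f →
      IntegrableOn (fun x => fderiv ℝ f x v) Ω := fun h c =>
    (((h.continuous_fderiv (by simp)).clm_apply continuous_const).integrable_of_hasCompactSupport
      (c.fderiv_apply ℝ v)).integrableOn
  have hb : ∀ {f : Euc m → ℝ}, ContDiff ℝ 1 f → HasCompactSupport f →
      IntegrableOn (fun x => f x * inner ℝ v (N x)) (frontier Ω) μHE[m - 1] := fun h c =>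
    (h.continuous.mul (continuous_const.inner hN)).integrable_of_hasCompactSupport c.mul_right
  have e : ∀ x, fderiv ℝ (fun x => f₁ x + f₂ x) x v = fderiv ℝ f₁ x v + fderiv ℝ f₂ x v :=
    fun x => by
      rw [fderiv_fun_add (h₁.differentiable (by simp) x) (h₂.differentiable (by simp) x)]; rfl
  simp only [fluxDefect, e, add_mul]
  rw [integral_add (hd h₁ c₁) (hd h₂ c₂), integral_add (hb h₁ c₁) (hb h₂ c₂)]
  ring

/-- The local error estimates add up to a global one, by splitting the function with cutoffs
`χ + (1 - χ) = 1`, which does not increase the total of the bounds `∫_∂Ω |f|`. -/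
theorem exists_isOpen_abs_fluxDefect_le {m : ℕ} {Ω : Set (Euc m)}
    (hΩ : IsSmoothBoundedDomain Ω) {N : Euc m → Euc m} (hNc : Continuous N)
    (hN : ∀ x ∈ frontier Ω, N x = outwardUnitNormal Ω x) (v : Euc m) {ε : ℝ} (hε : 0 < ε) :
    ∃ U : Set (Euc m), IsOpen U ∧ closure Ω ⊆ U ∧ ∀ f : Euc m → ℝ, ContDiff ℝ 1 f →
      HasCompactSupport f → tsupport f ⊆ U →
        |fluxDefect Ω N v f| ≤ ε * ‖v‖ * ∫ x in frontier Ω, |f x| ∂μHE[m - 1] := by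
  have hfin : IsFiniteMeasure ((μHE[m - 1] : Measure (Euc m)).restrict (frontier Ω)) :=
    ⟨by rw [Measure.restrict_apply_univ]; exact measure_frontier_lt_top hΩ⟩
  refine hΩ.isBounded.isCompact_closure.induction_on
    (p := fun s => ∃ U : Set (Euc m), IsOpen U ∧ s ⊆ U ∧ ∀ f : Euc m → ℝ, ContDiff ℝ 1 f →
      HasCompactSupport f → tsupport f ⊆ U →
        |fluxDefect Ω N v f| ≤ ε * ‖v‖ * ∫ x in frontier Ω, |f x| ∂μHE[m - 1]) ?_ ?_ ?_ ?_
  · refine ⟨∅, isOpen_empty, subset_rfl, fun f _ _ hf => ?_⟩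
    have : f = 0 := tsupport_eq_empty_iff.1 (Set.subset_empty_iff.1 hf)
    subst this
    simp [fluxDefect]
  · rintro s t hst ⟨U, hU, htU, h⟩
    exact ⟨U, hU, hst.trans htU, h⟩
  · rintro s t ⟨U, hU, hsU, h⟩ ⟨W, hW, htW, h'⟩
    refine ⟨U ∪ W, hU.union hW, Set.union_subset_union hsU htW, fun f hf hfc hfs => ?_⟩
    -- `χ = 1` on the part of the support of `f` outside `W`, so `(1 - χ) f` lives in `W`
    obtain ⟨χ, χs, χc, χU, χ1, χI⟩ := exists_contDiff_one_nhds_of_isCompact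
      (hfc.isCompact.diff hW) hU (fun x hx => (hfs hx.1).resolve_right hx.2)
    have χs1 : ContDiff ℝ 1 χ := χs.of_le (by exact_mod_cast le_top)
    have k1 : ContDiff ℝ 1 fun x => χ x * f x := χs1.mul hf
    have k2 : ContDiff ℝ 1 fun x => (1 - χ x) * f x := (contDiff_const.sub χs1).mul hf
    have c1 : HasCompactSupport fun x => χ x * f x := hfc.mul_left
    have c2 : HasCompactSupport fun x => (1 - χ x) * f x := hfc.mul_left
    have b1 := h _ k1 c1 ((tsupport_mul_subset_left (f := χ) (g := f)).trans χU)
    have b2 := h' _ k2 c2 (fun x hx => by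
      by_contra hxW
      have hxf : x ∈ tsupport f := tsupport_mul_subset_right (f := fun x => 1 - χ x) hx
      have hx1 : ∀ᶠ y in 𝓝 x, χ y = 1 :=
        χ1.filter_mono (nhds_le_nhdsSet (s := tsupport f \ W) ⟨hxf, hxW⟩)
      refine (notMem_tsupport_iff_eventuallyEq.2 ?_) hx
      filter_upwards [hx1] with y hy
      simp [hy])
    have hsum := fluxDefect_add hΩ hNc v k1 k2 c1 c2
    have hf' : (fun x => χ x * f x + (1 - χ x) * f x) = f := by
      funext x; ring
    rw [hf'] at hsum
    have i1 : Integrable (fun x => |χ x * f x|)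
        ((μHE[m - 1] : Measure (Euc m)).restrict (frontier Ω)) :=
      (k1.continuous.integrable_of_hasCompactSupport c1).abs
    have i2 : Integrable (fun x => |(1 - χ x) * f x|)
        ((μHE[m - 1] : Measure (Euc m)).restrict (frontier Ω)) :=
      (k2.continuous.integrable_of_hasCompactSupport c2).abs
    have habs : ∫ x in frontier Ω, |f x| ∂μHE[m - 1]
        = ∫ x in frontier Ω, |χ x * f x| ∂μHE[m - 1]
          + ∫ x in frontier Ω, |(1 - χ x) * f x| ∂μHE[m - 1] := by
      rw [← integral_add i1 i2]
      congr 1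
      funext x
      rw [abs_mul, abs_mul, abs_of_nonneg (χI x).1, abs_of_nonneg (sub_nonneg.2 (χI x).2)]
      ring
    rw [hsum, habs, mul_add]
    exact (abs_add_le _ _).trans (add_le_add b1 b2)
  · intro x hx
    by_cases hxf : x ∈ frontier Ω
    · obtain ⟨U, hU, hxU, -, h⟩ := exists_nhds_abs_integral_sub_le hΩ hNc hN hxf hε
      exact ⟨U, mem_nhdsWithin_of_mem_nhds (hU.mem_nhds hxU), U, hU, subset_rfl,
        fun f hf hfc hfs => h f hf hfc hfs v⟩
    · have hxΩ : x ∈ Ω := by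
        by_contra h
        exact hxf ⟨hx, by rwa [hΩ.isOpen.interior_eq]⟩
      refine ⟨Ω, mem_nhdsWithin_of_mem_nhds (hΩ.isOpen.mem_nhds hxΩ), Ω, hΩ.isOpen, subset_rfl,
        fun f hf hfc hfs => ?_⟩
      have h1 : ∫ x in Ω, fderiv ℝ f x v = 0 := by
        rw [setIntegral_eq_integral_of_forall_compl_eq_zero fun y hy => by
          rw [image_eq_zero_of_notMem_tsupport (f := fderiv ℝ f)
            fun h => hy (hfs (tsupport_fderiv_subset ℝ h))]; rfl]
        have := integral_mul_fderiv_eq_neg_fderiv_mul_of_integrable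
          (μ := (volume : Measure (Euc m)))
          (f := fun _ : Euc m => (1 : ℝ)) (g := f) (v := v) (by simp)
          (by
            simp only [one_mul]
            exact ((hf.continuous_fderiv (by simp)).clm_apply
              continuous_const).integrable_of_hasCompactSupport (hfc.fderiv_apply ℝ v))
          (by simpa using hf.continuous.integrable_of_hasCompactSupport hfc)
          (by simp) (fun y _ => hf.differentiable (by simp) y)
        simpa using this
      have h2 : ∫ x in frontier Ω, f x * inner ℝ v (N x) ∂μHE[m - 1] = 0 := by
        refine setIntegral_eq_zero_of_forall_eq_zero fun y hy => ?_
        have hyΩ : y ∉ Ω := fun h => hy.2 (by rwa [hΩ.isOpen.interior_eq])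
        rw [image_eq_zero_of_notMem_tsupport fun h => hyΩ (hfs h), zero_mul]
      rw [fluxDefect, h1, h2, sub_zero, abs_zero]
      have : 0 ≤ ∫ x in frontier Ω, |f x| ∂μHE[m - 1] := integral_nonneg fun x => abs_nonneg _
      positivity

/-- The divergence theorem for the field `f v` with `v` constant. -/
theorem setIntegral_fderiv_eq_integral_frontier {m : ℕ} {Ω : Set (Euc m)}
    (hΩ : IsSmoothBoundedDomain Ω) {N : Euc m → Euc m} (hNc : Continuous N)
    (hN : ∀ x ∈ frontier Ω, N x = outwardUnitNormal Ω x) {f : Euc m → ℝ} (hf : ContDiff ℝ 1 f)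
    (v : Euc m) :
    ∫ x in Ω, fderiv ℝ f x v = ∫ x in frontier Ω, f x * inner ℝ v (N x) ∂μHE[m - 1] := by
  set I := ∫ x in frontier Ω, |f x| ∂μHE[m - 1] with hI
  have hI0 : 0 ≤ I := integral_nonneg fun x => abs_nonneg _
  have key : ∀ ε > 0, |fluxDefect Ω N v f| ≤ ε * ‖v‖ * I := by
    intro ε hε
    obtain ⟨U, hU, hΩU, h⟩ := exists_isOpen_abs_fluxDefect_le hΩ hNc hN v hε
    obtain ⟨χ, χs, χc, χU, χ1, -⟩ := exists_contDiff_one_nhds_of_isCompact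
      hΩ.isBounded.isCompact_closure hU hΩU
    have h1 : ∀ x ∈ closure Ω, (fun y => χ y * f y) =ᶠ[𝓝 x] f := fun x hx => by
      filter_upwards [χ1.filter_mono (nhds_le_nhdsSet hx)] with y hy
      simp [hy]
    have h2 := h (fun x => χ x * f x) ((χs.of_le (by exact_mod_cast le_top)).mul hf)
      χc.mul_right ((tsupport_mul_subset_left (f := χ) (g := f)).trans χU)
    have e1 : fluxDefect Ω N v (fun x => χ x * f x) = fluxDefect Ω N v f := by
      rw [fluxDefect, fluxDefect]
      congr 1
      · refine setIntegral_congr_fun hΩ.isOpen.measurableSet fun x hx => ?_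
        rw [(h1 x (subset_closure hx)).fderiv_eq]
      · refine setIntegral_congr_fun isClosed_frontier.measurableSet fun x hx => ?_
        have hx1 : χ x * f x = f x := (h1 x hx.1).self_of_nhds
        simp only [hx1]
    have e2 : ∫ x in frontier Ω, |χ x * f x| ∂μHE[m - 1] = I := by
      refine setIntegral_congr_fun isClosed_frontier.measurableSet fun x hx => ?_
      have hx1 : χ x * f x = f x := (h1 x hx.1).self_of_nhds
      simp only [hx1]
    rwa [e1, e2] at h2
  have hz : |fluxDefect Ω N v f| ≤ 0 := by
    refine le_of_forall_pos_le_add fun δ hδ => ?_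
    -- the summand `1` keeps the denominator positive
    refine (key (δ / (‖v‖ * I + 1)) (by positivity)).trans ?_
    rw [zero_add, mul_assoc, div_mul_eq_mul_div, div_le_iff₀ (by positivity)]
    nlinarith [mul_nonneg (norm_nonneg v) hI0]
  exact sub_eq_zero.1 (abs_nonpos_iff.1 hz)

/-! ### The restricted dual inside the topological dual -/

namespace SmoothFun

theorem continuous_coe {m : ℕ} {S : Set (Euc m)} {F : Type} [NormedAddCommGroup F]
    [NormedSpace ℝ F] (f : SmoothFun S F) : Continuous f := by
  have : (f : S → F) = fun x : S => f.extension x := funext fun x => (f.extension_apply x).symm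
  rw [this]
  exact f.contDiff_extension.continuous.comp continuous_subtype_val

end SmoothFun

theorem integral_bodyMeasure {m : ℕ} {Ω : Set (Euc m)} (hΩ : IsSmoothBoundedDomain Ω)
    (f : Euc m → ℝ) : ∫ x, f x ∂bodyMeasure Ω = ∫ x in Ω, f x := by
  rw [bodyMeasure, integral_subtype_comap isClosed_closure.measurableSet]
  refine setIntegral_congr_set ?_
  rw [closure_eq_self_union_frontier]
  exact union_ae_eq_left_of_ae_eq_empty (ae_eq_empty.2 (volume_frontier_eq_zero hΩ))

theorem integral_boundaryMeasure {m : ℕ} {Ω : Set (Euc m)} (f : Euc m → ℝ) :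
    ∫ x, f x ∂boundaryMeasure Ω = ∫ x in frontier Ω, f x ∂μHE[m - 1] :=
  integral_subtype_comap isClosed_frontier.measurableSet f

theorem isFiniteMeasure_bodyMeasure {m : ℕ} {Ω : Set (Euc m)} (hΩ : IsSmoothBoundedDomain Ω) :
    IsFiniteMeasure (bodyMeasure Ω) := by
  refine ⟨?_⟩
  rw [bodyMeasure, (MeasurableEmbedding.subtype_coe isClosed_closure.measurableSet).comap_apply,
    Set.image_univ, Subtype.range_coe]
  exact hΩ.isBounded.isCompact_closure.measure_lt_top

theorem isFiniteMeasure_boundaryMeasure {m : ℕ} {Ω : Set (Euc m)}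
    (hΩ : IsSmoothBoundedDomain Ω) : IsFiniteMeasure (boundaryMeasure Ω) := by
  refine ⟨?_⟩
  rw [boundaryMeasure, (MeasurableEmbedding.subtype_coe
    isClosed_frontier.measurableSet).comap_apply, Set.image_univ, Subtype.range_coe]
  exact measure_frontier_lt_top hΩ

theorem integrable_bodyMeasure {m : ℕ} {Ω : Set (Euc m)} (hΩ : IsSmoothBoundedDomain Ω)
    {f : closure Ω → ℝ} (hf : Continuous f) : Integrable f (bodyMeasure Ω) := by
  have := isFiniteMeasure_bodyMeasure hΩ
  have : CompactSpace (closure Ω) := isCompact_iff_compactSpace.1 hΩ.isBounded.isCompact_closure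
  exact hf.integrable_of_hasCompactSupport (HasCompactSupport.of_compactSpace f)

theorem integrable_boundaryMeasure {m : ℕ} {Ω : Set (Euc m)} (hΩ : IsSmoothBoundedDomain Ω)
    {f : frontier Ω → ℝ} (hf : Continuous f) : Integrable f (boundaryMeasure Ω) := by
  have := isFiniteMeasure_boundaryMeasure hΩ
  have : CompactSpace (frontier Ω) := isCompact_iff_compactSpace.1
    (hΩ.isBounded.isCompact_closure.of_isClosed_subset isClosed_frontier frontier_subset_closure)
  exact hf.integrable_of_hasCompactSupport (HasCompactSupport.of_compactSpace f)

/-- The term `k = 0` of the seminorm controls the values of the function. -/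
theorem abs_le_seminormFamily {m : ℕ} (f : GlobalSmooth m) {n : ℕ} {x : Euc m}
    (hx : x ∈ Metric.closedBall (0 : Euc m) n) :
    |f.toFun x| ≤ GlobalSmooth.seminormFamily m n f := by
  have h1 : |f.toFun x| = ‖GlobalSmooth.derivOnBall n 0 f ⟨x, hx⟩‖ := by
    rw [← Real.norm_eq_abs, ← norm_iteratedFDeriv_zero (𝕜 := ℝ) (f := f.toFun) (x := x)]
    rfl
  rw [h1]
  refine (ContinuousMap.norm_coe_le_norm _ _).trans ?_
  have h2 := Finset.le_sup (s := Finset.range (n + 1)) (f := fun k =>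
    (normSeminorm ℝ C(Metric.closedBall (0 : Euc m) n, Euc m [×k]→L[ℝ] ℝ)).comp
      (GlobalSmooth.derivOnBall n k)) (Finset.mem_range.2 (Nat.succ_pos n))
  exact h2 f

/-- Every element of the restricted dual is a continuous linear functional: the pairing is bounded
by the supremum of the argument over the compact domain, because both measures are finite. -/
theorem exists_isIdentifiedWith {m : ℕ} {Ω : Set (Euc m)} (hΩ : IsSmoothBoundedDomain Ω)
    (a : RestrictedDual Ω) : ∃ T : TopDual Ω, IsIdentifiedWith T a := by
  have i1 : ∀ ψ : SmoothFun (closure Ω) ℝ, Integrable (fun x => a.1 x * ψ x) (bodyMeasure Ω) :=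
    fun ψ => integrable_bodyMeasure hΩ (a.1.continuous_coe.mul ψ.continuous_coe)
  have i2 : ∀ ψ : SmoothFun (closure Ω) ℝ,
      Integrable (fun x => a.2 x * ψ.restrict frontier_subset_closure x) (boundaryMeasure Ω) :=
    fun ψ => integrable_boundaryMeasure hΩ (a.2.continuous_coe.mul
      (ψ.restrict frontier_subset_closure).continuous_coe)
  let T₀ : SmoothFun (closure Ω) ℝ →ₗ[ℝ] ℝ :=
    { toFun := restrictedPairing a
      map_add' := fun ψ χ => by
        have e1 : ∀ x, a.1 x * (ψ + χ) x = a.1 x * ψ x + a.1 x * χ x := fun x => by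
          rw [SmoothFun.add_apply, mul_add]
        have e2 : ∀ x, a.2 x * (ψ + χ).restrict frontier_subset_closure x
            = a.2 x * ψ.restrict frontier_subset_closure x
              + a.2 x * χ.restrict frontier_subset_closure x := fun x => mul_add _ _ _
        simp only [restrictedPairing, e1, e2]
        rw [integral_add (i1 ψ) (i1 χ), integral_add (i2 ψ) (i2 χ)]
        ring
      map_smul' := fun c ψ => by
        have e1 : ∀ x, a.1 x * (c • ψ) x = c * (a.1 x * ψ x) := fun x => by
          rw [SmoothFun.smul_apply, smul_eq_mul, mul_left_comm]
        have e2 : ∀ x, a.2 x * (c • ψ).restrict frontier_subset_closure x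
            = c * (a.2 x * ψ.restrict frontier_subset_closure x) :=
          fun x => mul_left_comm _ _ _
        simp only [restrictedPairing, e1, e2, integral_const_mul, RingHom.id_apply, smul_eq_mul]
        ring }
  have hT₀ : Continuous T₀ := by
    rw [continuous_coinduced_dom]
    let R : GlobalSmooth m →ₗ[ℝ] SmoothFun (closure Ω) ℝ :=
      { toFun := GlobalSmooth.restrict (closure Ω)
        map_add' := fun _ _ => rfl
        map_smul' := fun _ _ => rfl }
    obtain ⟨r, hr⟩ := hΩ.isBounded.closure.subset_closedBall (0 : Euc m)
    obtain ⟨n, hn⟩ := exists_nat_ge r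
    have hsub : closure Ω ⊆ Metric.closedBall (0 : Euc m) n :=
      hr.trans (Metric.closedBall_subset_closedBall hn)
    have hp : WithSeminorms (GlobalSmooth.seminormFamily m) := ⟨rfl⟩
    have hA : 0 ≤ ∫ x, |a.1 x| ∂bodyMeasure Ω := integral_nonneg fun _ => abs_nonneg _
    have hB : 0 ≤ ∫ x, |a.2 x| ∂boundaryMeasure Ω := integral_nonneg fun _ => abs_nonneg _
    refine WithSeminorms.continuous_normedSpace_rng ℝ hp (T₀ ∘ₗ R) ⟨{n},
      ⟨(∫ x, |a.1 x| ∂bodyMeasure Ω) + ∫ x, |a.2 x| ∂boundaryMeasure Ω, add_nonneg hA hB⟩,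
      fun f => ?_⟩
    set M := GlobalSmooth.seminormFamily m n f with hM
    have hgoal : |restrictedPairing a (GlobalSmooth.restrict (closure Ω) f)|
        ≤ ((∫ x, |a.1 x| ∂bodyMeasure Ω) + ∫ x, |a.2 x| ∂boundaryMeasure Ω) * M := by
      have hb : ∀ x : closure Ω, |GlobalSmooth.restrict (closure Ω) f x| ≤ M := fun x =>
        abs_le_seminormFamily f (hsub x.2)
      rw [restrictedPairing, add_mul, ← integral_mul_const, ← integral_mul_const]
      refine (abs_add_le _ _).trans (add_le_add ?_ ?_)
      · rw [← Real.norm_eq_abs]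
        refine norm_integral_le_of_norm_le
          ((integrable_bodyMeasure hΩ a.1.continuous_coe.abs).mul_const M) (.of_forall fun x => ?_)
        rw [norm_mul, Real.norm_eq_abs, Real.norm_eq_abs]
        gcongr
        exact hb x
      · rw [← Real.norm_eq_abs]
        refine norm_integral_le_of_norm_le
          ((integrable_boundaryMeasure hΩ a.2.continuous_coe.abs).mul_const M)
          (.of_forall fun x => ?_)
        rw [norm_mul, Real.norm_eq_abs, Real.norm_eq_abs]
        gcongr
        exact hb ⟨x, frontier_subset_closure x.2⟩
    rw [Finset.sup_singleton]
    exact hgoal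
  exact ⟨⟨T₀, hT₀⟩, fun ψ => ⟨i1 ψ, i2 ψ, rfl⟩⟩

/-! ### Integration by parts for smooth functions on the closed domain -/

/-- Integration by parts against a smooth vector field. -/
theorem integral_inner_grad {m : ℕ} {Ω : Set (Euc m)} (hΩ : IsSmoothBoundedDomain Ω)
    (X : SmoothFun (closure Ω) (Euc m)) (n : SmoothFun (frontier Ω) (Euc m))
    (hn : ∀ x : frontier Ω, n x = outwardUnitNormal Ω x) (ψ : SmoothFun (closure Ω) ℝ) :
    ∫ x, inner ℝ (X x) (ψ.grad x) ∂bodyMeasure Ω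
      = (∫ x, (X.restrict frontier_subset_closure).dot n x
            * ψ.restrict frontier_subset_closure x ∂boundaryMeasure Ω)
        - ∫ x, X.div x * ψ x ∂bodyMeasure Ω := by
  set Y := X.extension with hY
  set f := ψ.extension with hf
  set N := n.extension with hN
  have hYd : ContDiff ℝ ∞ Y := X.contDiff_extension
  have hfd : ContDiff ℝ ∞ f := ψ.contDiff_extension
  have hNc : Continuous N := n.contDiff_extension.continuous
  have hNn : ∀ x ∈ frontier Ω, N x = outwardUnitNormal Ω x := fun x hx => by
    rw [hN, n.extension_apply ⟨x, hx⟩, hn]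
  have hfin : IsFiniteMeasure ((μHE[m - 1] : Measure (Euc m)).restrict (frontier Ω)) :=
    ⟨by rw [Measure.restrict_apply_univ]; exact measure_frontier_lt_top hΩ⟩
  have hcomp : ∀ i, ContDiff ℝ 1 fun x => Y x i * f x := fun i =>
    (((EuclideanSpace.proj (𝕜 := ℝ) i).contDiff.comp hYd).mul hfd).of_le (by exact_mod_cast le_top)
  have hder : ∀ i x, fderiv ℝ (fun x => Y x i * f x) x (EuclideanSpace.single i 1)
      = Y x i * fderiv ℝ f x (EuclideanSpace.single i 1)
        + (fderiv ℝ Y x (EuclideanSpace.single i 1)) i * f x := by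
    intro i x
    have h1 : HasFDerivAt (fun x => Y x i)
        ((EuclideanSpace.proj (𝕜 := ℝ) i).comp (fderiv ℝ Y x)) x :=
      (EuclideanSpace.proj (𝕜 := ℝ) i).hasFDerivAt.comp x
        (hYd.differentiable (by simp) x).hasFDerivAt
    have h2 := (h1.mul (hfd.differentiable (by simp) x).hasFDerivAt).fderiv
    have h3 : fderiv ℝ (fun x => Y x i * f x) x = _ := h2
    rw [h3]
    simp [mul_comm]
  have hdivthm : ∀ i, ∫ x in Ω, fderiv ℝ (fun x => Y x i * f x) x (EuclideanSpace.single i 1)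
      = ∫ x in frontier Ω, Y x i * f x * N x i ∂μHE[m - 1] := by
    intro i
    rw [setIntegral_fderiv_eq_integral_frontier hΩ hNc hNn (hcomp i)]
    simp [EuclideanSpace.inner_single_left]
  have hgrad : ∀ x, inner ℝ (Y x) (gradient f x)
      = ∑ i, Y x i * fderiv ℝ f x (EuclideanSpace.single i 1) := by
    intro x
    rw [real_inner_comm, gradient, InnerProductSpace.toDual_symm_apply]
    conv_lhs => rw [← (EuclideanSpace.basisFun (Fin m) ℝ).sum_repr (Y x)]
    simp
  have hK : IsCompact (closure Ω) := hΩ.isBounded.isCompact_closure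
  have hint : ∀ g : Euc m → ℝ, Continuous g → IntegrableOn g Ω := fun g hg =>
    (hg.continuousOn.integrableOn_compact hK).mono_set subset_closure
  have hintF : ∀ g : Euc m → ℝ, Continuous g → IntegrableOn g (frontier Ω) μHE[m - 1] :=
    fun g hg => by
      have hKf : IsCompact (frontier Ω) :=
        hK.of_isClosed_subset isClosed_frontier frontier_subset_closure
      have := hg.continuousOn.integrableOn_compact
        (μ := (μHE[m - 1] : Measure (Euc m)).restrict (frontier Ω)) hKf
      rwa [IntegrableOn, Measure.restrict_restrict isClosed_frontier.measurableSet,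
        Set.inter_self] at this
  -- the integrals over subtypes in terms of extensions to the whole space
  have e1 : ∫ x, inner ℝ (X x) (ψ.grad x) ∂bodyMeasure Ω
      = ∫ x in Ω, inner ℝ (Y x) (gradient f x) := by
    rw [← integral_bodyMeasure hΩ]
    refine integral_congr_ae (.of_forall fun x => ?_)
    simp only [hY, X.extension_apply]
    rfl
  have e2 : ∫ x, X.div x * ψ x ∂bodyMeasure Ω
      = ∫ x in Ω, (∑ i, (fderiv ℝ Y x (EuclideanSpace.single i 1)) i) * f x := by
    rw [← integral_bodyMeasure hΩ]
    refine integral_congr_ae (.of_forall fun x => ?_)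
    simp only [hf, ψ.extension_apply, SmoothFun.div, SmoothFun.mk_apply, hY]
  have e3 : ∫ x, (X.restrict frontier_subset_closure).dot n x
        * ψ.restrict frontier_subset_closure x ∂boundaryMeasure Ω
      = ∫ x in frontier Ω, inner ℝ (Y x) (N x) * f x ∂μHE[m - 1] := by
    rw [← integral_boundaryMeasure]
    refine integral_congr_ae (.of_forall fun x => ?_)
    simp only [hf, hN, hY, n.extension_apply]
    rw [X.extension_apply ⟨x, frontier_subset_closure x.2⟩,
      ψ.extension_apply ⟨x, frontier_subset_closure x.2⟩]
    rfl
  have hYi : ∀ i, Continuous fun x => Y x i := fun i =>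
    (EuclideanSpace.proj (𝕜 := ℝ) i).continuous.comp hYd.continuous
  have hNi : ∀ i, Continuous fun x => N x i := fun i =>
    (EuclideanSpace.proj (𝕜 := ℝ) i).continuous.comp hNc
  have hdfi : ∀ i : Fin m, Continuous fun x => fderiv ℝ f x (EuclideanSpace.single i 1) :=
    fun i => (hfd.continuous_fderiv (by simp)).clm_apply continuous_const
  have hdYi : ∀ i : Fin m, Continuous fun x => (fderiv ℝ Y x (EuclideanSpace.single i 1)) i :=
    fun i => (EuclideanSpace.proj (𝕜 := ℝ) i).continuous.comp
      ((hYd.continuous_fderiv (by simp)).clm_apply continuous_const)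
  rw [e1, e2, e3, eq_sub_iff_add_eq]
  have hfr : ∀ x, inner ℝ (Y x) (N x) * f x = ∑ i, Y x i * f x * N x i := fun x => by
    rw [PiLp.inner_apply, Finset.sum_mul]
    refine Finset.sum_congr rfl fun i _ => ?_
    simp; ring
  simp only [hfr, hgrad, Finset.sum_mul]
  have j1 : ∀ i, IntegrableOn (fun x => Y x i * fderiv ℝ f x (EuclideanSpace.single i 1)) Ω :=
    fun i => hint _ ((hYi i).mul (hdfi i))
  have j2 : ∀ i, IntegrableOn
      (fun x => (fderiv ℝ Y x (EuclideanSpace.single i 1)) i * f x) Ω :=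
    fun i => hint _ ((hdYi i).mul hfd.continuous)
  have j3 : ∀ i, IntegrableOn (fun x => Y x i * f x * N x i) (frontier Ω) μHE[m - 1] :=
    fun i => hintF _ (((hYi i).mul hfd.continuous).mul (hNi i))
  rw [integral_finsetSum _ fun i _ => j1 i, integral_finsetSum _ fun i _ => j2 i,
    integral_finsetSum _ fun i _ => j3 i, ← Finset.sum_add_distrib]
  refine Finset.sum_congr rfl fun i _ => ?_
  rw [← hdivthm i, ← integral_add (j1 i) (j2 i)]
  simp only [hder]

/-! ### The first variation of the Lagrangian -/

/-- Differentiation under the integral sign for a smooth integrand on a compact space. -/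
theorem hasDerivAt_integral_comp_add_smul {X Z : Type*} [TopologicalSpace X] [CompactSpace X]
    [MeasurableSpace X] [OpensMeasurableSpace X] [NormedAddCommGroup Z] [NormedSpace ℝ Z]
    {μ : Measure X} [IsFiniteMeasure μ] {ℓ : Z → ℝ} (hℓ : ContDiff ℝ 1 ℓ) {a b : X → Z}
    (ha : Continuous a) (hb : Continuous b) :
    HasDerivAt (fun ε : ℝ => ∫ x, ℓ (a x + ε • b x) ∂μ) (∫ x, fderiv ℝ ℓ (a x) (b x) ∂μ) 0 := by
  have hF : Continuous fun z : ℝ × X => fderiv ℝ ℓ (a z.2 + z.1 • b z.2) (b z.2) :=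
    ((hℓ.continuous_fderiv (by simp)).comp (by fun_prop)).clm_apply (by fun_prop)
  obtain ⟨C, hC⟩ := ((isCompact_closedBall (0 : ℝ) 1).prod
    (isCompact_univ (X := X))).exists_bound_of_continuousOn hF.continuousOn
  have hint : ∀ f : X → ℝ, Continuous f → Integrable f μ := fun f hf =>
    hf.integrable_of_hasCompactSupport (HasCompactSupport.of_compactSpace f)
  have h := (hasDerivAt_integral_of_dominated_loc_of_deriv_le (μ := μ) (x₀ := (0 : ℝ))
    (F := fun ε x => ℓ (a x + ε • b x))
    (F' := fun ε x => fderiv ℝ ℓ (a x + ε • b x) (b x)) (bound := fun _ => C)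
    (Metric.closedBall_mem_nhds 0 one_pos)
    (.of_forall fun ε => (hint _ (hℓ.continuous.comp (by fun_prop))).aestronglyMeasurable)
    (hint _ (hℓ.continuous.comp (by fun_prop)))
    (hint _ (hF.comp (by fun_prop : Continuous fun x : X => ((0 : ℝ), x)))).aestronglyMeasurable
    (.of_forall fun x ε hε => hC (ε, x) ⟨hε, Set.mem_univ x⟩) (integrable_const C)
    (.of_forall fun x ε _ => by
      have h1 : HasDerivAt (fun ε : ℝ => a x + ε • b x) (b x) ε := by
        simpa using ((hasDerivAt_id ε).smul_const (b x)).const_add (a x)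
      exact (hℓ.differentiable (by simp) _).hasFDerivAt.comp_hasDerivAt ε h1)).2
  simpa using h

section Density

variable {m : ℕ} {ℓ : ℝ × ℝ × Euc m → ℝ}

theorem fderiv_apply_phi (hℓ : ContDiff ℝ ∞ ℓ) (z : ℝ × ℝ × Euc m) :
    fderiv ℝ ℓ z (1, 0, 0) = densityPartialPhi ℓ z := by
  have h1 : HasDerivAt (fun s : ℝ => (s, z.2.1, z.2.2)) (1, 0, 0) z.1 :=
    (hasDerivAt_id z.1).prodMk (hasDerivAt_const _ _)
  exact ((hℓ.differentiable (by simp) z).hasFDerivAt.comp_hasDerivAt z.1 h1).deriv.symm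

theorem fderiv_apply_nu (hℓ : ContDiff ℝ ∞ ℓ) (z : ℝ × ℝ × Euc m) :
    fderiv ℝ ℓ z (0, 1, 0) = densityPartialNu ℓ z := by
  have h1 : HasDerivAt (fun s : ℝ => (z.1, s, z.2.2)) (0, 1, 0) z.2.1 :=
    (hasDerivAt_const _ _).prodMk ((hasDerivAt_id z.2.1).prodMk (hasDerivAt_const _ _))
  exact ((hℓ.differentiable (by simp) z).hasFDerivAt.comp_hasDerivAt z.2.1 h1).deriv.symm

theorem fderiv_apply_grad (hℓ : ContDiff ℝ ∞ ℓ) (z : ℝ × ℝ × Euc m) (ξ : Euc m) :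
    fderiv ℝ ℓ z (0, 0, ξ) = inner ℝ (densityPartialGrad ℓ z) ξ := by
  have h1 : HasFDerivAt (fun ξ : Euc m => (z.1, z.2.1, ξ))
      ((0 : Euc m →L[ℝ] ℝ).prod ((0 : Euc m →L[ℝ] ℝ).prod (ContinuousLinearMap.id ℝ (Euc m))))
      z.2.2 :=
    (hasFDerivAt_const z.1 z.2.2).prodMk
      ((hasFDerivAt_const z.2.1 z.2.2).prodMk (hasFDerivAt_id z.2.2))
  have h2 : fderiv ℝ (fun ξ : Euc m => ℓ (z.1, z.2.1, ξ)) z.2.2 = _ :=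
    ((hℓ.differentiable (by simp) z).hasFDerivAt.comp z.2.2 h1).fderiv
  rw [densityPartialGrad, gradient, InnerProductSpace.toDual_symm_apply, h2]
  simp

/-- The differential of the density, split into its partial derivatives. -/
theorem fderiv_density_apply (hℓ : ContDiff ℝ ∞ ℓ) (z : ℝ × ℝ × Euc m) (s t : ℝ) (ξ : Euc m) :
    fderiv ℝ ℓ z (s, t, ξ) = densityPartialPhi ℓ z * s + densityPartialNu ℓ z * t
      + inner ℝ (densityPartialGrad ℓ z) ξ := by
  have h : ((s, t, ξ) : ℝ × ℝ × Euc m)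
      = s • (1, 0, 0) + t • (0, 1, 0) + (0, 0, ξ) := by simp
  rw [h, map_add, map_add, map_smul, map_smul, fderiv_apply_phi hℓ, fderiv_apply_nu hℓ,
    fderiv_apply_grad hℓ, smul_eq_mul, smul_eq_mul]
  ring

variable {Ω : Set (Euc m)}

/-- The gradient is linear, although it is defined through a chosen extension. -/
theorem SmoothFun.grad_add_smul (hΩ : IsOpen Ω) (φ η : SmoothFun (closure Ω) ℝ) (ε : ℝ)
    (x : closure Ω) : (φ + ε • η).grad x = φ.grad x + ε • η.grad x := by
  have hc : ContDiff ℝ ∞ fun x => φ.extension x + ε • η.extension x :=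
    φ.contDiff_extension.add (η.contDiff_extension.const_smul ε)
  have h := SmoothFun.fderiv_extension_eq hΩ (φ + ε • η) hc
    (fun x => by simp [SmoothFun.extension_apply]) x
  have hφ := φ.contDiff_extension.differentiable (by simp) (x : Euc m)
  have hη := η.contDiff_extension.differentiable (by simp) (x : Euc m)
  have h' := (hφ.hasFDerivAt.add (hη.hasFDerivAt.const_smul ε)).fderiv
  replace h := h.trans h'
  simp only [SmoothFun.grad, SmoothFun.mk_apply, gradient, h, map_add, map_smul]

theorem hasDerivAt_lagrangian_phi (hΩ : IsSmoothBoundedDomain Ω) (hℓ : ContDiff ℝ ∞ ℓ)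
    (φ ν η : SmoothFun (closure Ω) ℝ) :
    HasDerivAt (fun ε : ℝ => lagrangian ℓ (φ + ε • η) ν)
      (∫ x, (partialPhi hℓ φ ν x * η x + inner ℝ (partialGrad hℓ φ ν x) (η.grad x))
        ∂bodyMeasure Ω) 0 := by
  have := isFiniteMeasure_bodyMeasure hΩ
  have : CompactSpace (closure Ω) := isCompact_iff_compactSpace.1 hΩ.isBounded.isCompact_closure
  have h := hasDerivAt_integral_comp_add_smul (μ := bodyMeasure Ω)
    (hℓ.of_le (by exact_mod_cast le_top))
    (a := fun x => (φ x, ν x, φ.grad x)) (b := fun x => (η x, (0 : ℝ), η.grad x))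
    (φ.continuous_coe.prodMk (ν.continuous_coe.prodMk φ.grad.continuous_coe))
    (η.continuous_coe.prodMk (continuous_const.prodMk η.grad.continuous_coe))
  convert h using 1
  · funext ε
    refine integral_congr_ae (.of_forall fun x => ?_)
    simp [SmoothFun.grad_add_smul hΩ.isOpen]
  · refine integral_congr_ae (.of_forall fun x => ?_)
    simp only [fderiv_density_apply hℓ, mul_zero, add_zero]
    rfl

theorem hasDerivAt_lagrangian_nu (hΩ : IsSmoothBoundedDomain Ω) (hℓ : ContDiff ℝ ∞ ℓ)
    (φ ν η : SmoothFun (closure Ω) ℝ) :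
    HasDerivAt (fun ε : ℝ => lagrangian ℓ φ (ν + ε • η))
      (∫ x, partialNu hℓ φ ν x * η x ∂bodyMeasure Ω) 0 := by
  have := isFiniteMeasure_bodyMeasure hΩ
  have : CompactSpace (closure Ω) := isCompact_iff_compactSpace.1 hΩ.isBounded.isCompact_closure
  have h := hasDerivAt_integral_comp_add_smul (μ := bodyMeasure Ω)
    (hℓ.of_le (by exact_mod_cast le_top))
    (a := fun x => (φ x, ν x, φ.grad x)) (b := fun x => ((0 : ℝ), η x, (0 : Euc m)))
    (φ.continuous_coe.prodMk (ν.continuous_coe.prodMk φ.grad.continuous_coe))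
    (continuous_const.prodMk (η.continuous_coe.prodMk continuous_const))
  convert h using 1
  · funext ε
    refine integral_congr_ae (.of_forall fun x => ?_)
    simp
  · refine integral_congr_ae (.of_forall fun x => ?_)
    simp only [fderiv_density_apply hℓ, mul_zero, zero_add, inner_zero_right, add_zero]
    rfl

end Density

theorem lemma3p10 {m : ℕ} (Ω : Set (Euc m)) (hΩ : IsSmoothBoundedDomain Ω)
    (ℓ : ℝ × ℝ × Euc m → ℝ) (hℓ : ContDiff ℝ ∞ ℓ) (φ ν : SmoothFun (closure Ω) ℝ) :
    ∃ n : SmoothFun (frontier Ω) (Euc m), (∀ x : frontier Ω, n x = outwardUnitNormal Ω x) ∧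
      (∃ T : TopDual Ω, HasFunctionalDerivAt (fun η => lagrangian ℓ η ν) T φ ∧
        IsIdentifiedWith T
          (partialPhi hℓ φ ν - (partialGrad hℓ φ ν).div,
            ((partialGrad hℓ φ ν).restrict frontier_subset_closure).dot n)) ∧
      (∃ T : TopDual Ω, HasFunctionalDerivAt (fun η => lagrangian ℓ φ η) T ν ∧
        IsIdentifiedWith T (partialNu hℓ φ ν, 0)) := by
  obtain ⟨N, hN, hNn⟩ := exists_contDiff_extension_outwardUnitNormal hΩ
  let n : SmoothFun (frontier Ω) (Euc m) := SmoothFun.mk N hN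
  have hn : ∀ x : frontier Ω, n x = outwardUnitNormal Ω x := fun x => hNn x x.2
  have hint : ∀ f g : SmoothFun (closure Ω) ℝ, Integrable (fun x => f x * g x) (bodyMeasure Ω) :=
    fun f g => integrable_bodyMeasure hΩ (f.continuous_coe.mul g.continuous_coe)
  refine ⟨n, hn, ?_, ?_⟩
  · obtain ⟨T, hT⟩ := exists_isIdentifiedWith hΩ (partialPhi hℓ φ ν - (partialGrad hℓ φ ν).div,
      ((partialGrad hℓ φ ν).restrict frontier_subset_closure).dot n)
    refine ⟨T, fun η => ?_, hT⟩
    have h := hasDerivAt_lagrangian_phi hΩ hℓ φ ν η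
    have hX : Integrable (fun x => inner ℝ (partialGrad hℓ φ ν x) (η.grad x)) (bodyMeasure Ω) :=
      integrable_bodyMeasure hΩ ((partialGrad hℓ φ ν).continuous_coe.inner η.grad.continuous_coe)
    rw [integral_add (hint _ _) hX, integral_inner_grad hΩ _ n hn] at h
    rw [(hT η).2.2, restrictedPairing]
    simp only [SmoothFun.sub_apply, sub_mul]
    rw [integral_sub (hint _ _) (hint _ _)]
    convert h using 1
    ring
  · obtain ⟨T, hT⟩ := exists_isIdentifiedWith hΩ (partialNu hℓ φ ν, 0)
    refine ⟨T, fun η => ?_, hT⟩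
    have h := hasDerivAt_lagrangian_nu hΩ hℓ φ ν η
    rw [(hT η).2.2, restrictedPairing]
    simpa using h
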